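/- Let $D\ge 1$. All random vectors take values in $\mathbb{R}^D$ and have densities with respect to Lebesgue measure; entropies are in nats. For a random vector $X$ with density $F$ and $p>1$ put $$I_p(X)=\frac{1}{1-p}\log\int_{\mathbb{R}^D}F^p\,dx ,\qquad N_p(X)=\frac{1}{2\pi}\,p^{-p'/p}\,\|F\|_p^{-2p'/D},\qquad p'=\frac{p}{p-1},$$ $$H(X)=-\int_{\mathbb{R}^D}F\log F\,dx,\qquad N(X)=\frac{1}{2\pi e}\exp\Big(\frac{2}{D}H(X)\Big).$$ If $F\in L^s(\mathbb{R}^D)$ for some $s>1$, then $H(X)$ is well defined in $(-\infty,+\infty]$; if $H(X)=+\infty$ we put $N(X)=+\infty$. 1. Let $p>1$ and let $X$ have a density $F\in L^p(\mathbb{R}^D)$. Then $0<N_p(X)<\infty$, and if $Z_G$ is a Gaussian random vector with zero mean and identity covariance matrix, then $N=N_p(X)$ is the unique $N>0$ with $I_p(X)=I_p(\sqrt{N}\,Z_G)$. 2. If $X$ has a density $F\in L^s(\mathbb{R}^D)$ for some $s>1$, then $N_p(X)\to N(X)$ as $p\to1_+$. 3. Let $r>1$, $\lambda\in(0,1)$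 and $$q=\frac{r}{(1-\lambda)+\lambda r},\qquad p=\frac{r}{\lambda+(1-\lambda)r}$$ (so that $1/q+1/p=1+1/r$). Let $X_1,X_2$ be independent with densities $F^{(1)}\in L^q(\mathbb{R}^D)$ and $F^{(2)}\in L^p(\mathbb{R}^D)$. Then $X_1+X_2$ has a density in $L^r(\mathbb{R}^D)$ and $$N_r(X_1+X_2)\ \ge\ \Big(\frac{N_q(X_1)}{1-\lambda}\Big)^{1-\lambda}\Big(\frac{N_p(X_2)}{\lambda}\Big)^{\lambda}.$$ 4. Let $X_1,X_2$ be independent with densities $F^{(1)}\in L^{s_1}(\mathbb{R}^D)$, $F^{(2)}\in L^{s_2}(\mathbb{R}^D)$ for some $s_1,s_2>1$. As $r\to1_+$, with $\lambda\in(0,1)$ fixed and $q,p$ the functions of $r$ and $\lambda$ given in 3, the left-hand side of the inequality in 3 tends to $N(X_1+X_2)$ and the right-hand side tends to $(N(X_1)/(1-\lambda))^{1-\lambda}(N(X_2)/\lambda)^{\lambda}$; hence $$N(X_1+X_2)\ \ge\ \Big(\frac{N(X_1)}{1-\lambda}\Big)^{1-\lambda}\Big(\frac{N(X_2)}{\lambda}\Big)^{\lambda}\qquad\text{for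 all }\lambda\in(0,1).$$ Moreover, the maximum over $\lambda\in(0,1)$ of the right-hand side is attained and equals $N(X_1)+N(X_2)$, so that Shannon's entropy power inequality $N(X_1+X_2)\ge N(X_1)+N(X_2)$ holds. -/

import Mathlib

open MeasureTheory ProbabilityTheory Filter Topology Set
open scoped ENNReal

noncomputable section

/-- The differential Rényi entropy of order `p` (in nats) of a random vector `X` in `ℝ^D` with
density `F`: `I_p(X) = 1 / (1 - p) * log (∫ F ^ p)`, an extended real number. -/
def renyiEntropy {Ω : Type*} [MeasurableSpace Ω] {D : ℕ} (p : ℝ)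
    (X : Ω → EuclideanSpace ℝ (Fin D)) (P : Measure Ω) : EReal :=
  ((1 / (1 - p) : ℝ) : EReal) * ENNReal.log (∫⁻ x, pdf X P volume x ^ p)

/-- The `p`-th Rényi entropy power `(2π)⁻¹ * p ^ (-p'/p) * ‖F‖_p ^ (-2p'/D)` of a random vector `X`
in `ℝ^D` with density `F`, where `p' = p / (p - 1)` is the Hölder conjugate of `p`. -/
def renyiEntropyPower {Ω : Type*} [MeasurableSpace Ω] {D : ℕ} (p : ℝ)
    (X : Ω → EuclideanSpace ℝ (Fin D)) (P : Measure Ω) : ℝ≥0∞ :=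
  ENNReal.ofReal ((2 * Real.pi)⁻¹ * p ^ (-(Real.conjExponent p / p))) *
    eLpNorm (pdf X P volume) (ENNReal.ofReal p) volume ^ (-(2 * Real.conjExponent p / D))

/-- The differential Shannon entropy (in nats) `-∫ F log F` of a random vector with density `F`,
as an extended real number: the integral of the positive part of `-F log F` minus the integral of
its negative part. -/
def shannonEntropy {Ω : Type*} [MeasurableSpace Ω] {D : ℕ}
    (X : Ω → EuclideanSpace ℝ (Fin D)) (P : Measure Ω) : EReal :=
  ((∫⁻ x, ENNReal.ofReal (Real.negMulLog (pdf X P volume x).toReal) : ℝ≥0∞) : EReal) -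
    ((∫⁻ x, ENNReal.ofReal (-Real.negMulLog (pdf X P volume x).toReal) : ℝ≥0∞) : EReal)

/-- The Shannon entropy power `N(X) = exp ((2 / D) * H(X)) / (2πe)`, with value `∞` when
`H(X) = +∞`. -/
def shannonEntropyPower {Ω : Type*} [MeasurableSpace Ω] {D : ℕ}
    (X : Ω → EuclideanSpace ℝ (Fin D)) (P : Measure Ω) : ℝ≥0∞ :=
  EReal.exp (((2 / D : ℝ) : EReal) * shannonEntropy X P) /
    ENNReal.ofReal (2 * Real.pi * Real.exp 1)

/-- The expression `(a / (1 - t)) ^ (1 - t) * (b / t) ^ t`. -/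
def weightedPowerBound (t : ℝ) (a b : ℝ≥0∞) : ℝ≥0∞ :=
  (a / ENNReal.ofReal (1 - t)) ^ (1 - t) * (b / ENNReal.ofReal t) ^ t

end

/-!
# The entropy power inequality via the sharp Young inequality

The Rényi entropy power inequality is the sharp Young convolution inequality for the densities,
rewritten: `N_r` is a negative power of the `L^r` norm, so that an upper bound for the norm of a
convolution is a lower bound for the entropy power of the sum, and the constants match exactly
(`weighted_entropyPower_eq_young`). Shannon's inequality is its limit as all orders decrease to one,
followed by an optimisation over the weight.

The sharp Young inequality is obtained from its trilinear form
`∫∫ f(x) ^ c₁ * g(y - x) ^ c₂ * h(y) ^ c₃ ≤ K * (∫ f) ^ c₁ * (∫ g) ^ c₂ * (∫ h) ^ c₃`, where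
`cᵢ = 1 - wᵢ` and `w₁ + w₂ + w₃ = 1`. On the line it is proved by mass transport. Increasing maps
`Sᵢ` carry the normalised functions to centred Gaussians (`exists_monotone_transport`), and they are
combined into the injective map `Θ(x, y) = (S₁ x - S₂ (y - x), S₂ (y - x) + S₃ y)` of the plane.
Its Jacobian `S₁' S₂' + S₁' S₃' + S₂' S₃'` dominates a multiple of `∏ Sᵢ' ^ cᵢ` by the inequality of
arithmetic and geometric means, and the product of the Gaussian factors is at most a Gaussian
evaluated at `Θ(x, y)`; the change of variables `Θ` then bounds the form by one Gaussian integral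
(`lintegral_trilinear_le_youngConst`). Since the maps `Sᵢ` are only differentiable almost
everywhere, the change of variables is made on a measurable set that carries the integrand, and no
regularisation of the functions is needed. The inequality tensorises (`TrilinearBound.prod`), and
testing it against truncated powers of `f ⋆ₗ g` gives Young's inequality in any dimension
(`TrilinearBound.lintegral_lconvolution_rpow_le`).

For the limit of the Rényi entropies, `∫ F ^ p = 1 - (p - 1) * (Q p - M p)`, where `Q p` and `M p`
integrate the positive and negative parts of `(F - F ^ p) / (p - 1)`. Fatou's lemma and dominated
convergence identify the limits of `Q p` and `M p` as the two parts of the Shannon entropy, the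
first of which may be infinite (`tendsto_log_lintegral_rpow`). The normalisation of the entropy
power is checked on Gaussian vectors by computing `∫ F ^ p` as a product of one-dimensional
integrals (`renyiEntropyPower_smul_stdGaussian`).
-/

/-! ### Monotone transport of densities on the line -/

/-- The distribution function of an integrable function tends to the total mass. -/
lemma tendsto_setIntegral_Iic_atTop {f : ℝ → ℝ} (hf : Integrable f) :
    Tendsto (fun t => ∫ x in Iic t, f x) atTop (𝓝 (∫ x, f x)) :=
  (aecover_Iic (μ := volume) (tendsto_id (α := ℝ))).integral_tendsto_of_countably_generated hf

lemma setIntegral_Iic_eq_add_intervalIntegral {f : ℝ → ℝ} (hf : Integrable f) (t : ℝ) :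
    ∫ x in Iic t, f x = (∫ x in Iic (0 : ℝ), f x) + ∫ x in (0 : ℝ)..t, f x := by
  rw [← intervalIntegral.integral_Iic_sub_Iic hf.integrableOn hf.integrableOn]
  ring

lemma monotone_setIntegral_Iic {f : ℝ → ℝ} (hf : Integrable f) (h0 : ∀ x, 0 ≤ f x) :
    Monotone fun t => ∫ x in Iic t, f x := fun _ _ hab =>
  setIntegral_mono_set hf.integrableOn (ae_of_all _ h0) (Iic_subset_Iic.2 hab).eventuallyLE

/-- A monotone function is strictly larger to the right of a point where its derivative is
positive. -/
lemma Monotone.lt_of_hasDerivAt_pos {F : ℝ → ℝ} (hF : Monotone F) {a b d : ℝ}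
    (hd : HasDerivAt F d a) (hpos : 0 < d) (hab : a < b) : F a < F b := by
  refine (hF hab.le).lt_of_ne fun heq => hpos.ne' ?_
  -- otherwise `F` is constant on `[a, b]`, so its right derivative at `a` vanishes
  have h1 : HasDerivWithinAt F d (Icc a b) a := hd.hasDerivWithinAt
  have h2 : HasDerivWithinAt F 0 (Icc a b) a :=
    (hasDerivWithinAt_const a (Icc a b) (F a)).congr
      (fun x hx => le_antisymm ((hF hx.2).trans heq.ge) (hF hx.1)) rfl
  exact (uniqueDiffOn_Icc hab a (left_mem_Icc.2 hab.le)).eq_deriv _ h1 h2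

lemma Monotone.lt_of_hasDerivAt_pos_left {F : ℝ → ℝ} (hF : Monotone F) {a b d : ℝ}
    (hd : HasDerivAt F d b) (hpos : 0 < d) (hab : a < b) : F a < F b := by
  refine (hF hab.le).lt_of_ne fun heq => hpos.ne' ?_
  have h1 : HasDerivWithinAt F d (Icc a b) b := hd.hasDerivWithinAt
  have h2 : HasDerivWithinAt F 0 (Icc a b) b :=
    (hasDerivWithinAt_const b (Icc a b) (F b)).congr
      (fun x hx => le_antisymm (hF hx.2) (heq.ge.trans (hF hx.1))) rfl
  exact (uniqueDiffOn_Icc hab b (right_mem_Icc.2 hab.le)).eq_deriv _ h1 h2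

/-- The distribution function of a continuous positive probability density has a continuous
strictly monotone inverse on `(0, 1)`. -/
lemma exists_quantile {γ : ℝ → ℝ} (hγc : Continuous γ) (hγ : ∀ x, 0 < γ x) (hγi : Integrable γ)
    (hγ1 : ∫ x, γ x = 1) :
    ∃ Q : ℝ → ℝ, StrictMonoOn Q (Ioo 0 1) ∧ ∀ y ∈ Ioo (0 : ℝ) 1, HasDerivAt Q (γ (Q y))⁻¹ y := by
  set G : ℝ → ℝ := fun t => ∫ x in Iic t, γ x with hG
  have hmono : Monotone G := monotone_setIntegral_Iic hγi fun x => (hγ x).le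
  have hder : ∀ t, HasDerivAt G (γ t) t := fun t => by
    have h := (intervalIntegral.integral_hasDerivAt_right (a := 0) (b := t)
      (hγc.intervalIntegrable _ _) hγc.stronglyMeasurable.stronglyMeasurableAtFilter
      hγc.continuousAt).const_add (∫ x in Iic (0 : ℝ), γ x)
    refine h.congr_of_eventuallyEq (Eventually.of_forall fun s => ?_)
    exact setIntegral_Iic_eq_add_intervalIntegral hγi s
  have hstrict : StrictMono G := fun a b hab => hmono.lt_of_hasDerivAt_pos (hder a) (hγ a) hab
  have hcont : Continuous G := continuous_iff_continuousAt.2 fun t => (hder t).continuousAt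
  have htop : Tendsto G atTop (𝓝 1) := hγ1 ▸ tendsto_setIntegral_Iic_atTop hγi
  have hbot : Tendsto G atBot (𝓝 0) := tendsto_integral_Iic_zero tendsto_id
  have hsurj : ∀ y ∈ Ioo (0 : ℝ) 1, ∃ x, G x = y := fun y hy => by
    obtain ⟨a, ha⟩ := (hbot.eventually (gt_mem_nhds hy.1)).exists
    obtain ⟨b, hb⟩ := (htop.eventually (lt_mem_nhds hy.2)).exists
    exact mem_range_of_exists_le_of_exists_ge hcont ⟨a, ha.le⟩ ⟨b, hb.le⟩
  have hmem : ∀ x, G x ∈ Ioo (0 : ℝ) 1 := fun x =>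
    ⟨(hmono.le_of_tendsto hbot (x - 1)).trans_lt (hstrict (by linarith)),
      (hstrict (by linarith : x < x + 1)).trans_le (hmono.ge_of_tendsto htop (x + 1))⟩
  set Q : ℝ → ℝ := Function.invFun G
  have hQG : ∀ x, Q (G x) = x := Function.leftInverse_invFun hstrict.injective
  have hGQ : ∀ y ∈ Ioo (0 : ℝ) 1, G (Q y) = y := fun y hy => Function.invFun_eq (hsurj y hy)
  have hQ : StrictMonoOn Q (Ioo 0 1) := fun y hy z hz hyz => by
    rw [← hstrict.lt_iff_lt, hGQ y hy, hGQ z hz]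
    exact hyz
  refine ⟨Q, hQ, fun y hy => ?_⟩
  have hn : Ioo (0 : ℝ) 1 ∈ 𝓝 y := Ioo_mem_nhds hy.1 hy.2
  have himg : Q '' Ioo (0 : ℝ) 1 = univ := eq_univ_of_forall fun x => ⟨G x, hmem x, hQG x⟩
  refine HasDerivAt.of_local_left_inverse
    (hQ.continuousAt_of_image_mem_nhds hn (by simp [himg])) (hder (Q y)) (hγ _).ne' ?_
  filter_upwards [hn] with z hz using hGQ z hz

/-- Monotone transport: a probability density `f` on the line is carried to a continuous positive
probability density `γ` by an increasing map `T`. The Monge–Ampère equation `f = T' * γ ∘ T` holds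
on a set `A` that contains almost every point where `f` does not vanish. -/
lemma exists_monotone_transport {f γ : ℝ → ℝ} (hf : Measurable f) (hf0 : ∀ x, 0 ≤ f x)
    (hfi : Integrable f) (hf1 : ∫ x, f x = 1) (hγc : Continuous γ) (hγ : ∀ x, 0 < γ x)
    (hγi : Integrable γ) (hγ1 : ∫ x, γ x = 1) :
    ∃ (T : ℝ → ℝ) (A : Set ℝ), MeasurableSet A ∧ (∀ᵐ t, f t ≠ 0 → t ∈ A) ∧ StrictMonoOn T A ∧
      ∀ t ∈ A, ∃ d, 0 < d ∧ HasDerivAt T d t ∧ f t = d * γ (T t) := by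
  obtain ⟨Q, hQ, hQd⟩ := exists_quantile hγc hγ hγi hγ1
  set F : ℝ → ℝ := fun t => ∫ x in Iic t, f x with hF
  have hmono : Monotone F := monotone_setIntegral_Iic hfi hf0
  have htop : Tendsto F atTop (𝓝 1) := hf1 ▸ tendsto_setIntegral_Iic_atTop hfi
  have hbot : Tendsto F atBot (𝓝 0) := tendsto_integral_Iic_zero tendsto_id
  have hder : ∀ᵐ t, HasDerivAt F (f t) t := by
    filter_upwards [LocallyIntegrable.ae_hasDerivAt_integral hfi.locallyIntegrable] with t ht
    refine ((ht 0).const_add (∫ x in Iic (0 : ℝ), f x)).congr_of_eventuallyEq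
      (Eventually.of_forall fun s => ?_)
    exact setIntegral_Iic_eq_add_intervalIntegral hfi s
  obtain ⟨N, hN, hNm, hN0⟩ := exists_measurable_superset_of_null (ae_iff.1 hder)
  set A : Set ℝ := Nᶜ ∩ {t | f t ≠ 0} with hA
  have hAder : ∀ t ∈ A, HasDerivAt F (f t) t := fun t ht => by
    by_contra h
    exact ht.1 (hN h)
  have hApos : ∀ t ∈ A, 0 < f t := fun t ht => (hf0 t).lt_of_ne' ht.2
  have hAmem : ∀ t ∈ A, F t ∈ Ioo (0 : ℝ) 1 := fun t ht =>
    ⟨(hmono.le_of_tendsto hbot (t - 1)).trans_lt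
      (hmono.lt_of_hasDerivAt_pos_left (hAder t ht) (hApos t ht) (by linarith)),
    (hmono.lt_of_hasDerivAt_pos (hAder t ht) (hApos t ht) (by linarith : t < t + 1)).trans_le
      (hmono.ge_of_tendsto htop (t + 1))⟩
  refine ⟨fun t => Q (F t), A, hNm.compl.inter (hf (measurableSet_singleton 0).compl), ?_, ?_, ?_⟩
  · filter_upwards [compl_mem_ae_iff.2 hN0] with t ht h using ⟨ht, h⟩
  · exact fun s hs t ht hst => hQ (hAmem s hs) (hAmem t ht)
      (hmono.lt_of_hasDerivAt_pos (hAder s hs) (hApos s hs) hst)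
  · intro t ht
    refine ⟨(γ (Q (F t)))⁻¹ * f t, mul_pos (inv_pos.2 (hγ _)) (hApos t ht),
      (hQd _ (hAmem t ht)).comp t (hAder t ht), ?_⟩
    field_simp [(hγ (Q (F t))).ne']

/-! ### Gaussian integrals -/

lemma lintegral_exp_neg_mul_sq {b : ℝ} (hb : 0 < b) :
    ∫⁻ x : ℝ, ENNReal.ofReal (Real.exp (-b * x ^ 2)) = ENNReal.ofReal √(Real.pi / b) := by
  rw [← integral_gaussian, ofReal_integral_eq_lintegral_ofReal (integrable_exp_neg_mul_sq hb)
    (ae_of_all _ fun x => (Real.exp_pos _).le)]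

/-- The Gaussian integral of a positive definite binary quadratic form. -/
lemma lintegral_exp_neg_binary_form {a b c : ℝ} (ha : 0 < a) (hdet : 0 < a * c - b ^ 2) :
    ∫⁻ z : ℝ × ℝ, ENNReal.ofReal
        (Real.exp (-(a * z.1 ^ 2 + 2 * b * (z.1 * z.2) + c * z.2 ^ 2))) =
      ENNReal.ofReal (Real.pi / √(a * c - b ^ 2)) := by
  rw [Measure.volume_eq_prod, lintegral_prod_symm' _ (by fun_prop)]
  have hd : 0 < (a * c - b ^ 2) / a := div_pos hdet ha
  -- completing the square in the first variable
  have key : ∀ y x : ℝ, ENNReal.ofReal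
      (Real.exp (-(a * x ^ 2 + 2 * b * (x * y) + c * y ^ 2))) =
      ENNReal.ofReal (Real.exp (-((a * c - b ^ 2) / a) * y ^ 2)) *
        ENNReal.ofReal (Real.exp (-a * (x + b / a * y) ^ 2)) := fun y x => by
    rw [← ENNReal.ofReal_mul (Real.exp_pos _).le, ← Real.exp_add]
    congr 2
    field_simp
    ring
  simp_rw [key]
  have inner : ∀ y : ℝ, ∫⁻ x : ℝ, ENNReal.ofReal (Real.exp (-((a * c - b ^ 2) / a) * y ^ 2)) *
        ENNReal.ofReal (Real.exp (-a * (x + b / a * y) ^ 2)) =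
      ENNReal.ofReal (Real.exp (-((a * c - b ^ 2) / a) * y ^ 2)) *
        ENNReal.ofReal √(Real.pi / a) := fun y => by
    rw [lintegral_const_mul _ (by fun_prop), lintegral_add_right_eq_self
      (fun x : ℝ => ENNReal.ofReal (Real.exp (-a * x ^ 2))), lintegral_exp_neg_mul_sq ha]
  simp_rw [inner]
  rw [lintegral_mul_const _ (by fun_prop), lintegral_exp_neg_mul_sq hd,
    ← ENNReal.ofReal_mul (Real.sqrt_nonneg _), ← Real.sqrt_mul (by positivity)]
  congr 1
  rw [show Real.pi / ((a * c - b ^ 2) / a) * (Real.pi / a) = Real.pi ^ 2 / (a * c - b ^ 2) by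
    field_simp, Real.sqrt_div (by positivity), Real.sqrt_sq Real.pi_pos.le]

/-! ### The sharp trilinear inequality on the line -/

/-- The constant `∏ᵢ (wᵢ ^ wᵢ / (1 - wᵢ) ^ (1 - wᵢ)) ^ (1 / 2)` of the sharp Young inequality for
the exponents `1 / (1 - wᵢ)`, where `w₁ + w₂ + w₃ = 1`. -/
noncomputable def youngConst (w₁ w₂ w₃ : ℝ) : ℝ :=
  √(w₁ ^ w₁ / (1 - w₁) ^ (1 - w₁) * (w₂ ^ w₂ / (1 - w₂) ^ (1 - w₂)) *
    (w₃ ^ w₃ / (1 - w₃) ^ (1 - w₃)))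

/-- The centred Gaussian probability density on the line proportional to `exp (-b * x ^ 2)`. -/
noncomputable def gaussDensity (b x : ℝ) : ℝ := √(b / Real.pi) * Real.exp (-b * x ^ 2)

lemma gaussDensity_pos {b : ℝ} (hb : 0 < b) (x : ℝ) : 0 < gaussDensity b x :=
  mul_pos (Real.sqrt_pos.2 (div_pos hb Real.pi_pos)) (Real.exp_pos _)

lemma continuous_gaussDensity (b : ℝ) : Continuous (gaussDensity b) := by
  unfold gaussDensity; fun_prop

lemma integrable_gaussDensity {b : ℝ} (hb : 0 < b) : Integrable (gaussDensity b) :=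
  (integrable_exp_neg_mul_sq hb).const_mul _

lemma integral_gaussDensity {b : ℝ} (hb : 0 < b) : ∫ x, gaussDensity b x = 1 := by
  unfold gaussDensity
  rw [integral_const_mul, integral_gaussian, ← Real.sqrt_mul (by positivity)]
  rw [show b / Real.pi * (Real.pi / b) = 1 by field_simp [Real.pi_pos.ne'], Real.sqrt_one]

lemma gaussDensity_rpow {w : ℝ} (hw : 0 < w) (hw1 : w < 1) (x : ℝ) :
    gaussDensity (w / (1 - w)) x ^ (1 - w) =
      (w / (1 - w) / Real.pi) ^ ((1 - w) / 2) * Real.exp (-w * x ^ 2) := by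
  have hc : 0 < 1 - w := sub_pos.2 hw1
  unfold gaussDensity
  rw [Real.mul_rpow (Real.sqrt_nonneg _) (Real.exp_pos _).le, Real.sqrt_eq_rpow,
    ← Real.rpow_mul (by positivity), ← Real.exp_mul]
  congr 2
  · ring
  · field_simp

/-- The determinant inequality behind the transport argument: for positive `dᵢ`, weighted
arithmetic and geometric means bound `∏ dᵢ ^ (1 - wᵢ)` by the Jacobian `d₂d₃ + d₁d₃ + d₁d₂`. -/
lemma prod_rpow_le_jacobian {w₁ w₂ w₃ d₁ d₂ d₃ : ℝ} (h₁ : 0 < w₁) (h₂ : 0 < w₂) (h₃ : 0 < w₃)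
    (hw : w₁ + w₂ + w₃ = 1) (hd₁ : 0 < d₁) (hd₂ : 0 < d₂) (hd₃ : 0 < d₃) :
    d₁ ^ (1 - w₁) * d₂ ^ (1 - w₂) * d₃ ^ (1 - w₃) ≤
      w₁ ^ w₁ * w₂ ^ w₂ * w₃ ^ w₃ * (d₂ * d₃ + d₁ * d₃ + d₁ * d₂) := by
  have key := Real.geom_mean_le_arith_mean3_weighted h₁.le h₂.le h₃.le
    (div_pos (mul_pos hd₂ hd₃) h₁).le (div_pos (mul_pos hd₁ hd₃) h₂).le
    (div_pos (mul_pos hd₁ hd₂) h₃).le hw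
  have e : w₁ * (d₂ * d₃ / w₁) + w₂ * (d₁ * d₃ / w₂) + w₃ * (d₁ * d₂ / w₃) =
      d₂ * d₃ + d₁ * d₃ + d₁ * d₂ := by field_simp
  rw [e, Real.div_rpow (by positivity) h₁.le, Real.div_rpow (by positivity) h₂.le,
    Real.div_rpow (by positivity) h₃.le, Real.mul_rpow hd₂.le hd₃.le, Real.mul_rpow hd₁.le hd₃.le,
    Real.mul_rpow hd₁.le hd₂.le] at key
  rw [show 1 - w₁ = w₂ + w₃ by linarith, show 1 - w₂ = w₁ + w₃ by linarith,
    show 1 - w₃ = w₁ + w₂ by linarith, Real.rpow_add hd₁, Real.rpow_add hd₂, Real.rpow_add hd₃]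
  have hW : 0 < w₁ ^ w₁ * w₂ ^ w₂ * w₃ ^ w₃ := by positivity
  calc _ = w₁ ^ w₁ * w₂ ^ w₂ * w₃ ^ w₃ * (d₂ ^ w₁ * d₃ ^ w₁ / w₁ ^ w₁ *
        (d₁ ^ w₂ * d₃ ^ w₂ / w₂ ^ w₂) * (d₁ ^ w₃ * d₂ ^ w₃ / w₃ ^ w₃)) := by
        field_simp [(Real.rpow_pos_of_pos h₁ w₁).ne', (Real.rpow_pos_of_pos h₂ w₂).ne',
          (Real.rpow_pos_of_pos h₃ w₃).ne']
    _ ≤ _ := mul_le_mul_of_nonneg_left key hW.le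

/-- The pointwise estimate behind the transport argument: the product of the transported densities
is dominated by the Jacobian times the Gaussian of the transported point `(s₁ - s₂, s₂ + s₃)`. The
quadratic form is the variance of `(z₁, 0, -z₂)` for the weights `w`. -/
lemma transport_integrand_le {w₁ w₂ w₃ d₁ d₂ d₃ : ℝ} (h₁ : 0 < w₁) (h₂ : 0 < w₂) (h₃ : 0 < w₃)
    (hw : w₁ + w₂ + w₃ = 1) (hd₁ : 0 < d₁) (hd₂ : 0 < d₂) (hd₃ : 0 < d₃) (s₁ s₂ s₃ : ℝ) :
    (d₁ * gaussDensity (w₁ / (1 - w₁)) s₁) ^ (1 - w₁) *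
      (d₂ * gaussDensity (w₂ / (1 - w₂)) s₂) ^ (1 - w₂) *
      (d₃ * gaussDensity (w₃ / (1 - w₃)) s₃) ^ (1 - w₃) ≤
    (w₁ ^ w₁ * w₂ ^ w₂ * w₃ ^ w₃ * ((w₁ / (1 - w₁) / Real.pi) ^ ((1 - w₁) / 2) *
      (w₂ / (1 - w₂) / Real.pi) ^ ((1 - w₂) / 2) * (w₃ / (1 - w₃) / Real.pi) ^ ((1 - w₃) / 2))) *
    ((d₂ * d₃ + d₁ * d₃ + d₁ * d₂) * Real.exp (-(w₁ * (1 - w₁) * (s₁ - s₂) ^ 2 +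
      2 * (w₁ * w₃) * ((s₁ - s₂) * (s₂ + s₃)) + w₃ * (1 - w₃) * (s₂ + s₃) ^ 2))) := by
  have hw₁ : w₁ < 1 := by linarith
  have hw₂ : w₂ < 1 := by linarith
  have hw₃ : w₃ < 1 := by linarith
  have c₁ : 0 < 1 - w₁ := by linarith
  have c₂ : 0 < 1 - w₂ := by linarith
  have c₃ : 0 < 1 - w₃ := by linarith
  rw [Real.mul_rpow hd₁.le (gaussDensity_pos (div_pos h₁ c₁) _).le,
    Real.mul_rpow hd₂.le (gaussDensity_pos (div_pos h₂ c₂) _).le,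
    Real.mul_rpow hd₃.le (gaussDensity_pos (div_pos h₃ c₃) _).le,
    gaussDensity_rpow h₁ hw₁, gaussDensity_rpow h₂ hw₂, gaussDensity_rpow h₃ hw₃]
  set B := (w₁ / (1 - w₁) / Real.pi) ^ ((1 - w₁) / 2) *
      (w₂ / (1 - w₂) / Real.pi) ^ ((1 - w₂) / 2) *
      (w₃ / (1 - w₃) / Real.pi) ^ ((1 - w₃) / 2) with hB
  have hBpos : 0 < B := by positivity
  have hjac := prod_rpow_le_jacobian h₁ h₂ h₃ hw hd₁ hd₂ hd₃
  have hexp : Real.exp (-w₁ * s₁ ^ 2) * Real.exp (-w₂ * s₂ ^ 2) * Real.exp (-w₃ * s₃ ^ 2) ≤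
      Real.exp (-(w₁ * (1 - w₁) * (s₁ - s₂) ^ 2 +
      2 * (w₁ * w₃) * ((s₁ - s₂) * (s₂ + s₃)) + w₃ * (1 - w₃) * (s₂ + s₃) ^ 2)) := by
    rw [← Real.exp_add, ← Real.exp_add, Real.exp_le_exp]
    obtain rfl : w₂ = 1 - w₁ - w₃ := by linarith
    nlinarith [sq_nonneg (w₁ * s₁ + (1 - w₁ - w₃) * s₂ - w₃ * s₃)]
  calc _ = B * ((d₁ ^ (1 - w₁) * d₂ ^ (1 - w₂) * d₃ ^ (1 - w₃)) *
        (Real.exp (-w₁ * s₁ ^ 2) * Real.exp (-w₂ * s₂ ^ 2) * Real.exp (-w₃ * s₃ ^ 2))) := by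
        rw [hB]; ring
    _ ≤ B * ((w₁ ^ w₁ * w₂ ^ w₂ * w₃ ^ w₃ * (d₂ * d₃ + d₁ * d₃ + d₁ * d₂)) *
        Real.exp (-(w₁ * (1 - w₁) * (s₁ - s₂) ^ 2 +
        2 * (w₁ * w₃) * ((s₁ - s₂) * (s₂ + s₃)) + w₃ * (1 - w₃) * (s₂ + s₃) ^ 2))) := by
        gcongr
    _ = _ := by ring

/-- The constant of the pointwise estimate times the Gaussian integral of its quadratic form is the
sharp constant; the determinant of the form is `w₁ * w₂ * w₃`. -/
lemma transport_const_eq {w₁ w₂ w₃ : ℝ} (h₁ : 0 < w₁) (h₂ : 0 < w₂) (h₃ : 0 < w₃)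
    (hw : w₁ + w₂ + w₃ = 1) :
    (w₁ ^ w₁ * w₂ ^ w₂ * w₃ ^ w₃ * ((w₁ / (1 - w₁) / Real.pi) ^ ((1 - w₁) / 2) *
      (w₂ / (1 - w₂) / Real.pi) ^ ((1 - w₂) / 2) * (w₃ / (1 - w₃) / Real.pi) ^ ((1 - w₃) / 2))) *
      (Real.pi / √(w₁ * (1 - w₁) * (w₃ * (1 - w₃)) - (w₁ * w₃) ^ 2)) = youngConst w₁ w₂ w₃ := by
  have c₁ : 0 < 1 - w₁ := by linarith
  have c₂ : 0 < 1 - w₂ := by linarith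
  have c₃ : 0 < 1 - w₃ := by linarith
  have hπ := Real.pi_pos
  rw [show w₁ * (1 - w₁) * (w₃ * (1 - w₃)) - (w₁ * w₃) ^ 2 = w₁ * w₂ * w₃ by
    obtain rfl : w₂ = 1 - w₁ - w₃ := by linarith
    ring]
  unfold youngConst
  refine Real.log_injOn_pos ?_ ?_ ?_
  · exact mem_Ioi.2 (by positivity)
  · exact mem_Ioi.2 (by positivity)
  rw [Real.log_sqrt (by positivity), Real.log_mul (by positivity) (by positivity),
    Real.log_mul (by positivity) (by positivity), Real.log_mul (by positivity) (by positivity),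
    Real.log_mul (by positivity) (by positivity), Real.log_mul (by positivity) (by positivity),
    Real.log_mul (by positivity) (by positivity), Real.log_div (by positivity) (by positivity),
    Real.log_sqrt (by positivity), Real.log_mul (by positivity) (by positivity),
    Real.log_mul (by positivity) (by positivity), Real.log_mul (by positivity) (by positivity),
    Real.log_mul (by positivity) (by positivity), Real.log_div (by positivity) (by positivity),
    Real.log_div (by positivity) (by positivity), Real.log_div (by positivity) (by positivity)]
  rw [Real.log_rpow h₁, Real.log_rpow h₂, Real.log_rpow h₃, Real.log_rpow c₁, Real.log_rpow c₂,
    Real.log_rpow c₃, Real.log_rpow (by positivity), Real.log_rpow (by positivity),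
    Real.log_rpow (by positivity), Real.log_div (by positivity) hπ.ne',
    Real.log_div h₁.ne' c₁.ne', Real.log_div (by positivity) hπ.ne',
    Real.log_div h₂.ne' c₂.ne', Real.log_div (by positivity) hπ.ne',
    Real.log_div h₃.ne' c₃.ne']
  obtain rfl : w₂ = 1 - w₁ - w₃ := by linarith
  ring

/-- The derivative of the transport map `(x, y) ↦ (S₁ x - S₂ (y - x), S₂ (y - x) + S₃ y)`. -/
noncomputable def transportFDeriv (d₁ d₂ d₃ : ℝ) : ℝ × ℝ →L[ℝ] ℝ × ℝ :=
  (Matrix.toLin (.finTwoProd ℝ) (.finTwoProd ℝ)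
    !![d₁ + d₂, -d₂; -d₂, d₂ + d₃]).toContinuousLinearMap

lemma det_transportFDeriv (d₁ d₂ d₃ : ℝ) :
    (transportFDeriv d₁ d₂ d₃).det = d₂ * d₃ + d₁ * d₃ + d₁ * d₂ := by
  unfold transportFDeriv
  simp only [LinearMap.det_toContinuousLinearMap, LinearMap.det_toLin, Matrix.det_fin_two_of]
  ring

lemma hasFDerivAt_transport {S₁ S₂ S₃ : ℝ → ℝ} {d₁ d₂ d₃ : ℝ} {z : ℝ × ℝ}
    (h₁ : HasDerivAt S₁ d₁ z.1) (h₂ : HasDerivAt S₂ d₂ (z.2 - z.1)) (h₃ : HasDerivAt S₃ d₃ z.2) :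
    HasFDerivAt (fun z : ℝ × ℝ => (S₁ z.1 - S₂ (z.2 - z.1), S₂ (z.2 - z.1) + S₃ z.2))
      (transportFDeriv d₁ d₂ d₃) z := by
  unfold transportFDeriv
  rw [Matrix.toLin_finTwoProd_toContinuousLinearMap]
  have p₁ : HasFDerivAt (fun z : ℝ × ℝ => z.1) (ContinuousLinearMap.fst ℝ ℝ ℝ) z := hasFDerivAt_fst
  have p₂ : HasFDerivAt (fun z : ℝ × ℝ => z.2) (ContinuousLinearMap.snd ℝ ℝ ℝ) z := hasFDerivAt_snd
  have e₁ := HasDerivAt.comp_hasFDerivAt z h₁ p₁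
  have e₂ := HasDerivAt.comp_hasFDerivAt (f := fun z : ℝ × ℝ => z.2 - z.1) z h₂ (p₂.sub p₁)
  have e₃ := HasDerivAt.comp_hasFDerivAt z h₃ p₂
  refine ((e₁.sub e₂).prodMk (e₂.add e₃)).congr_fderiv ?_
  ext <;> simp [sub_eq_add_neg]

/-- The transport map is injective where its three components are strictly monotone. -/
lemma injOn_transport {S₁ S₂ S₃ : ℝ → ℝ} {A₁ A₂ A₃ : Set ℝ} (h₁ : StrictMonoOn S₁ A₁)
    (h₂ : StrictMonoOn S₂ A₂) (h₃ : StrictMonoOn S₃ A₃) :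
    InjOn (fun z : ℝ × ℝ => (S₁ z.1 - S₂ (z.2 - z.1), S₂ (z.2 - z.1) + S₃ z.2))
      {z | z.1 ∈ A₁ ∧ z.2 - z.1 ∈ A₂ ∧ z.2 ∈ A₃} := by
  have key : ∀ {S : ℝ → ℝ} {A : Set ℝ}, StrictMonoOn S A → ∀ a ∈ A, ∀ b ∈ A,
      0 ≤ (S a - S b) * (a - b) ∧ ((S a - S b) * (a - b) = 0 → a = b) := by
    intro S A hS a ha b hb
    rcases lt_trichotomy a b with h | h | h
    · have := mul_pos_of_neg_of_neg (sub_neg.2 (hS ha hb h)) (sub_neg.2 h)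
      exact ⟨this.le, fun h0 => absurd h0 this.ne'⟩
    · exact ⟨by simp [h], fun _ => h⟩
    · have := mul_pos (sub_pos.2 (hS hb ha h)) (sub_pos.2 h)
      exact ⟨this.le, fun h0 => absurd h0 this.ne'⟩
  rintro ⟨x, y⟩ ⟨hx, hxy, hy⟩ ⟨x', y'⟩ ⟨hx', hxy', hy'⟩ heq
  simp only [Prod.mk.injEq] at heq hx hxy hy hx' hxy' hy' ⊢
  obtain ⟨a₁, b₁⟩ := key h₁ x hx x' hx'
  obtain ⟨a₂, b₂⟩ := key h₂ (y - x) hxy (y' - x') hxy'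
  obtain ⟨a₃, b₃⟩ := key h₃ y hy y' hy'
  -- the inner product of the increments of the map and of its argument vanishes
  have hsum : (S₁ x - S₁ x') * (x - x') + (S₂ (y - x) - S₂ (y' - x')) * (y - x - (y' - x')) +
      (S₃ y - S₃ y') * (y - y') = 0 := by
    linear_combination (x - x') * heq.1 + (y - y') * heq.2
  exact ⟨b₁ (by linarith), b₃ (by linarith)⟩

lemma quasiMeasurePreserving_snd_sub_fst (E : Type*) [AddCommGroup E] [MeasureSpace E]
    [MeasurableAdd₂ E] [MeasurableNeg E] [SFinite (volume : Measure E)]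
    [(volume : Measure E).IsAddRightInvariant] :
    Measure.QuasiMeasurePreserving (fun z : E × E => z.2 - z.1) :=
  Measure.quasiMeasurePreserving_snd.comp
    (measurePreserving_prod_sub (volume : Measure E) volume).quasiMeasurePreserving

/-- The sharp trilinear inequality on the line for probability densities. All three densities are
transported to Gaussians for which the pointwise estimate integrates to the sharp constant. -/
lemma lintegral_trilinear_le_youngConst {w₁ w₂ w₃ : ℝ} (h₁ : 0 < w₁) (h₂ : 0 < w₂) (h₃ : 0 < w₃)
    (hw : w₁ + w₂ + w₃ = 1) {f g h : ℝ → ℝ} (hf : Measurable f) (hg : Measurable g)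
    (hh : Measurable h) (hf0 : ∀ x, 0 ≤ f x) (hg0 : ∀ x, 0 ≤ g x) (hh0 : ∀ x, 0 ≤ h x)
    (hfi : Integrable f) (hgi : Integrable g) (hhi : Integrable h)
    (hf1 : ∫ x, f x = 1) (hg1 : ∫ x, g x = 1) (hh1 : ∫ x, h x = 1) :
    ∫⁻ z : ℝ × ℝ, ENNReal.ofReal
        (f z.1 ^ (1 - w₁) * g (z.2 - z.1) ^ (1 - w₂) * h z.2 ^ (1 - w₃)) ≤
      ENNReal.ofReal (youngConst w₁ w₂ w₃) := by
  have c₁ : 0 < 1 - w₁ := by linarith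
  have c₂ : 0 < 1 - w₂ := by linarith
  have c₃ : 0 < 1 - w₃ := by linarith
  have b₁ := div_pos h₁ c₁
  have b₂ := div_pos h₂ c₂
  have b₃ := div_pos h₃ c₃
  obtain ⟨S₁, A₁, hA₁, hfA, hS₁, hd₁⟩ := exists_monotone_transport hf hf0 hfi hf1
    (continuous_gaussDensity _) (gaussDensity_pos b₁) (integrable_gaussDensity b₁)
    (integral_gaussDensity b₁)
  obtain ⟨S₂, A₂, hA₂, hgA, hS₂, hd₂⟩ := exists_monotone_transport hg hg0 hgi hg1
    (continuous_gaussDensity _) (gaussDensity_pos b₂) (integrable_gaussDensity b₂)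
    (integral_gaussDensity b₂)
  obtain ⟨S₃, A₃, hA₃, hhA, hS₃, hd₃⟩ := exists_monotone_transport hh hh0 hhi hh1
    (continuous_gaussDensity _) (gaussDensity_pos b₃) (integrable_gaussDensity b₃)
    (integral_gaussDensity b₃)
  choose! D₁ hD₁ hSD₁ hfD using hd₁
  choose! D₂ hD₂ hSD₂ hgD using hd₂
  choose! D₃ hD₃ hSD₃ hhD using hd₃
  set Θ : ℝ × ℝ → ℝ × ℝ := fun z => (S₁ z.1 - S₂ (z.2 - z.1), S₂ (z.2 - z.1) + S₃ z.2) with hΘ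
  set s : Set (ℝ × ℝ) := {z | z.1 ∈ A₁ ∧ z.2 - z.1 ∈ A₂ ∧ z.2 ∈ A₃} with hs
  have hsm : MeasurableSet s :=
    (measurable_fst hA₁).inter (((measurable_snd.sub measurable_fst) hA₂).inter
      (measurable_snd hA₃))
  set K : ℝ := w₁ ^ w₁ * w₂ ^ w₂ * w₃ ^ w₃ * ((w₁ / (1 - w₁) / Real.pi) ^ ((1 - w₁) / 2) *
      (w₂ / (1 - w₂) / Real.pi) ^ ((1 - w₂) / 2) *
      (w₃ / (1 - w₃) / Real.pi) ^ ((1 - w₃) / 2)) with hK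
  have hK0 : 0 ≤ K := by positivity
  set E : ℝ × ℝ → ℝ≥0∞ := fun z => ENNReal.ofReal (Real.exp (-(w₁ * (1 - w₁) * z.1 ^ 2 +
      2 * (w₁ * w₃) * (z.1 * z.2) + w₃ * (1 - w₃) * z.2 ^ 2))) with hE
  -- almost everywhere outside `s` one of the factors vanishes
  have hae : ∀ᵐ z : ℝ × ℝ, z ∉ s →
      f z.1 ^ (1 - w₁) * g (z.2 - z.1) ^ (1 - w₂) * h z.2 ^ (1 - w₃) = 0 := by
    have q₁ : ∀ᵐ z : ℝ × ℝ, f z.1 ≠ 0 → z.1 ∈ A₁ :=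
      (Measure.quasiMeasurePreserving_fst (μ := volume) (ν := volume)).ae hfA
    have q₃ : ∀ᵐ z : ℝ × ℝ, h z.2 ≠ 0 → z.2 ∈ A₃ :=
      (Measure.quasiMeasurePreserving_snd (μ := volume) (ν := volume)).ae hhA
    have q₂ : ∀ᵐ z : ℝ × ℝ, g (z.2 - z.1) ≠ 0 → z.2 - z.1 ∈ A₂ :=
      (quasiMeasurePreserving_snd_sub_fst ℝ).ae hgA
    filter_upwards [q₁, q₂, q₃] with z k₁ k₂ k₃ hz
    by_contra hne
    refine hz ⟨k₁ fun h0 => hne ?_, k₂ fun h0 => hne ?_, k₃ fun h0 => hne ?_⟩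
    · rw [h0, Real.zero_rpow c₁.ne']; ring
    · rw [h0, Real.zero_rpow c₂.ne']; ring
    · rw [h0, Real.zero_rpow c₃.ne']; ring
  calc ∫⁻ z : ℝ × ℝ, ENNReal.ofReal
        (f z.1 ^ (1 - w₁) * g (z.2 - z.1) ^ (1 - w₂) * h z.2 ^ (1 - w₃))
      = ∫⁻ z in s, ENNReal.ofReal
        (f z.1 ^ (1 - w₁) * g (z.2 - z.1) ^ (1 - w₂) * h z.2 ^ (1 - w₃)) := by
        rw [← lintegral_indicator hsm]
        refine lintegral_congr_ae ?_
        filter_upwards [hae] with z hz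
        by_cases hzs : z ∈ s
        · rw [indicator_of_mem hzs]
        · rw [indicator_of_notMem hzs, hz hzs, ENNReal.ofReal_zero]
    _ ≤ ∫⁻ z in s, ENNReal.ofReal K * (ENNReal.ofReal
          |(transportFDeriv (D₁ z.1) (D₂ (z.2 - z.1)) (D₃ z.2)).det| * E (Θ z)) := by
        refine setLIntegral_mono' hsm fun z hz => ?_
        obtain ⟨m₁, m₂, m₃⟩ := hz
        have p₁ := hD₁ _ m₁
        have p₂ := hD₂ _ m₂
        have p₃ := hD₃ _ m₃
        rw [det_transportFDeriv, abs_of_pos (by positivity), hE,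
          ← ENNReal.ofReal_mul (by positivity), ← ENNReal.ofReal_mul hK0]
        refine ENNReal.ofReal_le_ofReal ?_
        rw [hfD _ m₁, hgD _ m₂, hhD _ m₃]
        exact transport_integrand_le h₁ h₂ h₃ hw p₁ p₂ p₃ _ _ _
    _ = ENNReal.ofReal K * ∫⁻ z in Θ '' s, E z := by
        rw [lintegral_const_mul' _ _ ENNReal.ofReal_ne_top,
          lintegral_image_eq_lintegral_abs_det_fderiv_mul volume hsm
            (fun z hz => (hasFDerivAt_transport (hSD₁ _ hz.1) (hSD₂ _ hz.2.1)
              (hSD₃ _ hz.2.2)).hasFDerivWithinAt) (injOn_transport hS₁ hS₂ hS₃)]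
    _ ≤ ENNReal.ofReal K * ∫⁻ z, E z := by
        exact mul_le_mul_right (setLIntegral_le_lintegral _ _) _
    _ = ENNReal.ofReal (youngConst w₁ w₂ w₃) := by
        have hdet : w₁ * (1 - w₁) * (w₃ * (1 - w₃)) - (w₁ * w₃) ^ 2 = w₁ * w₂ * w₃ := by
          obtain rfl : w₂ = 1 - w₁ - w₃ := by linarith
          ring
        rw [hE, lintegral_exp_neg_binary_form (by positivity) (by rw [hdet]; positivity),
          ← ENNReal.ofReal_mul hK0, hK, transport_const_eq h₁ h₂ h₃ hw]

/-! ### The trilinear inequality for arbitrary functions and its tensorisation -/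

/-- The trilinear form of Young's convolution inequality on `E`, with constant `K`, for
`f ^ c₁`, `g ^ c₂` and `h ^ c₃`. -/
def TrilinearBound (E : Type*) [AddCommGroup E] [MeasureSpace E] (c₁ c₂ c₃ : ℝ) (K : ℝ≥0∞) :
    Prop :=
  ∀ f g h : E → ℝ≥0∞, Measurable f → Measurable g → Measurable h →
    ∫⁻ y, ∫⁻ x, f x ^ c₁ * g (y - x) ^ c₂ * h y ^ c₃ ≤
      K * ((∫⁻ x, f x) ^ c₁ * (∫⁻ x, g x) ^ c₂ * (∫⁻ x, h x) ^ c₃)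

lemma lintegral_lintegral_eq_lintegral_prod {E : Type*} [AddCommGroup E] [MeasureSpace E]
    [MeasurableSub₂ E] [SFinite (volume : Measure E)] {f g h : E → ℝ≥0∞} (c₁ c₂ c₃ : ℝ)
    (hf : Measurable f) (hg : Measurable g) (hh : Measurable h) :
    ∫⁻ y, ∫⁻ x, f x ^ c₁ * g (y - x) ^ c₂ * h y ^ c₃ =
      ∫⁻ z : E × E, f z.1 ^ c₁ * g (z.2 - z.1) ^ c₂ * h z.2 ^ c₃ := by
  rw [Measure.volume_eq_prod, lintegral_prod_symm']
  have := hg.comp (measurable_snd.sub (measurable_fst (α := E) (β := E)))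
  exact (((hf.comp measurable_fst).pow_const _).mul (this.pow_const _)).mul
    ((hh.comp measurable_snd).pow_const _)

/-- A function of finite nonzero mass is its mass times a real probability density. -/
lemma exists_density_of_lintegral {f : ℝ → ℝ≥0∞} (hf : Measurable f) (h0 : ∫⁻ x, f x ≠ 0)
    (hT : ∫⁻ x, f x ≠ ∞) :
    ∃ F : ℝ → ℝ, Measurable F ∧ (∀ x, 0 ≤ F x) ∧ Integrable F ∧ ∫ x, F x = 1 ∧
      ∀ᵐ x, f x = (∫⁻ x, f x) * ENNReal.ofReal (F x) := by
  set m := ∫⁻ x, f x with hm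
  have hmas : ∫⁻ x, f x / m = 1 := by
    simp_rw [div_eq_mul_inv]
    rw [lintegral_mul_const _ hf, ENNReal.mul_inv_cancel h0 hT]
  have hmeas : Measurable fun x => f x / m := hf.div_const m
  have hfin : ∀ᵐ x, f x / m < ∞ := ae_lt_top hmeas (by rw [hmas]; exact ENNReal.one_ne_top)
  refine ⟨fun x => (f x / m).toReal, hmeas.ennreal_toReal, fun x => ENNReal.toReal_nonneg,
    integrable_toReal_of_lintegral_ne_top hmeas.aemeasurable
      (by rw [hmas]; exact ENNReal.one_ne_top), ?_, ?_⟩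
  · rw [integral_toReal hmeas.aemeasurable hfin, hmas, ENNReal.toReal_one]
  · filter_upwards [hfin] with x hx
    rw [ENNReal.ofReal_toReal hx.ne, ENNReal.mul_div_cancel h0 hT]

lemma youngConst_pos {w₁ w₂ w₃ : ℝ} (h₁ : 0 < w₁) (h₂ : 0 < w₂) (h₃ : 0 < w₃)
    (hw : w₁ + w₂ + w₃ = 1) : 0 < youngConst w₁ w₂ w₃ := by
  have c₁ : 0 < 1 - w₁ := by linarith
  have c₂ : 0 < 1 - w₂ := by linarith
  have c₃ : 0 < 1 - w₃ := by linarith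
  unfold youngConst
  positivity

/-- The sharp trilinear inequality on the line for arbitrary functions, by homogeneity; functions of
zero or infinite mass make it trivial. -/
lemma trilinearBound_real {w₁ w₂ w₃ : ℝ} (h₁ : 0 < w₁) (h₂ : 0 < w₂) (h₃ : 0 < w₃)
    (hw : w₁ + w₂ + w₃ = 1) :
    TrilinearBound ℝ (1 - w₁) (1 - w₂) (1 - w₃) (ENNReal.ofReal (youngConst w₁ w₂ w₃)) := by
  have c₁ : 0 < 1 - w₁ := by linarith
  have c₂ : 0 < 1 - w₂ := by linarith
  have c₃ : 0 < 1 - w₃ := by linarith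
  intro f g h hf hg hh
  rw [lintegral_lintegral_eq_lintegral_prod _ _ _ hf hg hh]
  have q₁ : ∀ {p : ℝ → Prop}, (∀ᵐ x, p x) → ∀ᵐ z : ℝ × ℝ, p z.1 := fun hp =>
    (Measure.quasiMeasurePreserving_fst (μ := volume) (ν := volume)).ae hp
  have q₃ : ∀ {p : ℝ → Prop}, (∀ᵐ x, p x) → ∀ᵐ z : ℝ × ℝ, p z.2 := fun hp =>
    (Measure.quasiMeasurePreserving_snd (μ := volume) (ν := volume)).ae hp
  have q₂ : ∀ {p : ℝ → Prop}, (∀ᵐ x, p x) → ∀ᵐ z : ℝ × ℝ, p (z.2 - z.1) := fun hp =>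
    (quasiMeasurePreserving_snd_sub_fst ℝ).ae hp
  have hz : ∀ {u : ℝ × ℝ → ℝ≥0∞} {R : ℝ≥0∞}, (∀ᵐ z, u z = 0) → ∫⁻ z, u z ≤ R := by
    intro u R hu
    rw [lintegral_congr_ae hu]
    simp
  by_cases f0 : ∫⁻ x, f x = 0
  · refine hz ?_
    filter_upwards [q₁ ((lintegral_eq_zero_iff hf).1 f0)] with z hz
    simp [hz, ENNReal.zero_rpow_of_pos c₁]
  by_cases g0 : ∫⁻ x, g x = 0
  · refine hz ?_
    filter_upwards [q₂ ((lintegral_eq_zero_iff hg).1 g0)] with z hz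
    simp [hz, ENNReal.zero_rpow_of_pos c₂]
  by_cases h0 : ∫⁻ x, h x = 0
  · refine hz ?_
    filter_upwards [q₃ ((lintegral_eq_zero_iff hh).1 h0)] with z hz
    simp [hz, ENNReal.zero_rpow_of_pos c₃]
  have n₁ : (∫⁻ x, f x) ^ (1 - w₁) ≠ 0 := by simp [ENNReal.rpow_eq_zero_iff, f0, c₁.le.not_gt]
  have n₂ : (∫⁻ x, g x) ^ (1 - w₂) ≠ 0 := by simp [ENNReal.rpow_eq_zero_iff, g0, c₂.le.not_gt]
  have n₃ : (∫⁻ x, h x) ^ (1 - w₃) ≠ 0 := by simp [ENNReal.rpow_eq_zero_iff, h0, c₃.le.not_gt]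
  have nK : ENNReal.ofReal (youngConst w₁ w₂ w₃) ≠ 0 :=
    (ENNReal.ofReal_pos.2 (youngConst_pos h₁ h₂ h₃ hw)).ne'
  by_cases fT : ∫⁻ x, f x = ∞
  · rw [fT, ENNReal.top_rpow_of_pos c₁, ENNReal.top_mul n₂, ENNReal.top_mul n₃,
      ENNReal.mul_top nK]
    exact le_top
  by_cases gT : ∫⁻ x, g x = ∞
  · rw [gT, ENNReal.top_rpow_of_pos c₂, ENNReal.mul_top n₁, ENNReal.top_mul n₃,
      ENNReal.mul_top nK]
    exact le_top
  by_cases hT : ∫⁻ x, h x = ∞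
  · rw [hT, ENNReal.top_rpow_of_pos c₃, ENNReal.mul_top (mul_ne_zero n₁ n₂), ENNReal.mul_top nK]
    exact le_top
  obtain ⟨F, hFm, hF0, hFi, hF1, hFe⟩ := exists_density_of_lintegral hf f0 fT
  obtain ⟨G, hGm, hG0, hGi, hG1, hGe⟩ := exists_density_of_lintegral hg g0 gT
  obtain ⟨H, hHm, hH0, hHi, hH1, hHe⟩ := exists_density_of_lintegral hh h0 hT
  set M := (∫⁻ x, f x) ^ (1 - w₁) * (∫⁻ x, g x) ^ (1 - w₂) * (∫⁻ x, h x) ^ (1 - w₃) with hM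
  calc ∫⁻ z : ℝ × ℝ, f z.1 ^ (1 - w₁) * g (z.2 - z.1) ^ (1 - w₂) * h z.2 ^ (1 - w₃)
      = ∫⁻ z : ℝ × ℝ, M * ENNReal.ofReal
        (F z.1 ^ (1 - w₁) * G (z.2 - z.1) ^ (1 - w₂) * H z.2 ^ (1 - w₃)) := by
        refine lintegral_congr_ae ?_
        filter_upwards [q₁ hFe, q₂ hGe, q₃ hHe] with z e₁ e₂ e₃
        rw [e₁, e₂, e₃, ENNReal.mul_rpow_of_nonneg _ _ c₁.le, ENNReal.mul_rpow_of_nonneg _ _ c₂.le,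
          ENNReal.mul_rpow_of_nonneg _ _ c₃.le, ENNReal.ofReal_rpow_of_nonneg (hF0 _) c₁.le,
          ENNReal.ofReal_rpow_of_nonneg (hG0 _) c₂.le, ENNReal.ofReal_rpow_of_nonneg (hH0 _) c₃.le,
          ENNReal.ofReal_mul (mul_nonneg (Real.rpow_nonneg (hF0 _) _) (Real.rpow_nonneg (hG0 _) _)),
          ENNReal.ofReal_mul (Real.rpow_nonneg (hF0 _) _), hM]
        ring
    _ ≤ M * ENNReal.ofReal (youngConst w₁ w₂ w₃) := by
        have hm : Measurable fun z : ℝ × ℝ => ENNReal.ofReal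
            (F z.1 ^ (1 - w₁) * G (z.2 - z.1) ^ (1 - w₂) * H z.2 ^ (1 - w₃)) := by fun_prop
        rw [lintegral_const_mul _ hm]
        exact mul_le_mul_right (lintegral_trilinear_le_youngConst h₁ h₂ h₃ hw hFm hGm hHm hF0 hG0
          hH0 hFi hGi hHi hF1 hG1 hH1) _
    _ = _ := mul_comm _ _

/-- The trilinear inequality tensorises: it is applied in the second variable for fixed first
variables, and then in the first variable to the resulting marginals. -/
lemma TrilinearBound.prod {E F : Type*} [AddCommGroup E] [MeasureSpace E] [MeasurableSub₂ E]
    [SFinite (volume : Measure E)] [AddCommGroup F] [MeasureSpace F] [MeasurableSub₂ F]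
    [SFinite (volume : Measure F)] {c₁ c₂ c₃ : ℝ} {K L : ℝ≥0∞}
    (hE : TrilinearBound E c₁ c₂ c₃ K) (hF : TrilinearBound F c₁ c₂ c₃ L) :
    TrilinearBound (E × F) c₁ c₂ c₃ (K * L) := by
  intro f g h hf hg hh
  have mf : Measurable fun x : E => ∫⁻ x', f (x, x') := hf.lintegral_prod_right'
  have mg : Measurable fun x : E => ∫⁻ x', g (x, x') := hg.lintegral_prod_right'
  have mh : Measurable fun x : E => ∫⁻ x', h (x, x') := hh.lintegral_prod_right'
  have hpow : ∀ {α : Type _} [MeasurableSpace α] {u v w : α → E × F}, Measurable u →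
      Measurable v → Measurable w →
      Measurable fun a => f (u a) ^ c₁ * g (v a) ^ c₂ * h (w a) ^ c₃ := fun hu hv hw =>
    (((hf.comp hu).pow_const _).mul ((hg.comp hv).pow_const _)).mul ((hh.comp hw).pow_const _)
  calc ∫⁻ y : E × F, ∫⁻ x : E × F, f x ^ c₁ * g (y - x) ^ c₂ * h y ^ c₃
      = ∫⁻ y : E, ∫⁻ y' : F, ∫⁻ x : E, ∫⁻ x' : F,
        f (x, x') ^ c₁ * g (y - x, y' - x') ^ c₂ * h (y, y') ^ c₃ := by
        rw [Measure.volume_eq_prod, lintegral_prod]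
        · refine lintegral_congr fun y => lintegral_congr fun y' => ?_
          rw [lintegral_prod]
          · rfl
          · exact (hpow measurable_id ((measurable_const.sub measurable_fst).prodMk
              (measurable_const.sub measurable_snd)) measurable_const).aemeasurable
        · refine (Measurable.lintegral_prod_right' (f := fun q : (E × F) × (E × F) =>
            f q.2 ^ c₁ * g (q.1 - q.2) ^ c₂ * h q.1 ^ c₃) ?_).aemeasurable
          exact hpow measurable_snd ((measurable_fst.fst.sub measurable_snd.fst).prodMk
            (measurable_fst.snd.sub measurable_snd.snd)) measurable_fst
    _ = ∫⁻ y : E, ∫⁻ x : E, ∫⁻ y' : F, ∫⁻ x' : F,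
        f (x, x') ^ c₁ * g (y - x, y' - x') ^ c₂ * h (y, y') ^ c₃ := by
        refine lintegral_congr fun y => lintegral_lintegral_swap ?_
        refine (Measurable.lintegral_prod_right' (f := fun q : (F × E) × F =>
            f (q.1.2, q.2) ^ c₁ * g (y - q.1.2, q.1.1 - q.2) ^ c₂ * h (y, q.1.1) ^ c₃)
            ?_).aemeasurable
        exact hpow (by fun_prop) (by fun_prop) (by fun_prop)
    _ ≤ ∫⁻ y : E, ∫⁻ x : E, L * ((∫⁻ x', f (x, x')) ^ c₁ * (∫⁻ x', g (y - x, x')) ^ c₂ *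
          (∫⁻ x', h (y, x')) ^ c₃) :=
        lintegral_mono fun y => lintegral_mono fun x =>
          hF (fun x' => f (x, x')) (fun x' => g (y - x, x')) (fun x' => h (y, x'))
            (hf.comp measurable_prodMk_left) (hg.comp measurable_prodMk_left)
            (hh.comp measurable_prodMk_left)
    _ = L * ∫⁻ y : E, ∫⁻ x : E, (∫⁻ x', f (x, x')) ^ c₁ * (∫⁻ x', g (y - x, x')) ^ c₂ *
          (∫⁻ x', h (y, x')) ^ c₃ := by
        have hm : Measurable fun q : E × E => (∫⁻ x', f (q.2, x')) ^ c₁ *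
            (∫⁻ x', g (q.1 - q.2, x')) ^ c₂ * (∫⁻ x', h (q.1, x')) ^ c₃ :=
          (((mf.comp measurable_snd).pow_const _).mul
            ((mg.comp (measurable_fst.sub measurable_snd)).pow_const _)).mul
            ((mh.comp measurable_fst).pow_const _)
        rw [← lintegral_const_mul _ hm.lintegral_prod_right']
        refine lintegral_congr fun y => ?_
        exact lintegral_const_mul L (hm.comp (measurable_prodMk_left (x := y)))
    _ ≤ L * (K * ((∫⁻ x, ∫⁻ x', f (x, x')) ^ c₁ * (∫⁻ x, ∫⁻ x', g (x, x')) ^ c₂ *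
          (∫⁻ x, ∫⁻ x', h (x, x')) ^ c₃)) := mul_le_mul_right (hE _ _ _ mf mg mh) _
    _ = _ := by
        rw [Measure.volume_eq_prod, lintegral_prod _ hf.aemeasurable,
          lintegral_prod _ hg.aemeasurable, lintegral_prod _ hh.aemeasurable]
        ring

/-- The trilinear inequality is invariant under measure preserving additive isomorphisms. -/
lemma TrilinearBound.of_measurePreserving {E F : Type*} [AddCommGroup E] [MeasureSpace E]
    [AddCommGroup F] [MeasureSpace F] {c₁ c₂ c₃ : ℝ} {K : ℝ≥0∞} (e : E ≃ᵐ F)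
    (he : MeasurePreserving e) (hsub : ∀ x y, e (x - y) = e x - e y)
    (hE : TrilinearBound E c₁ c₂ c₃ K) : TrilinearBound F c₁ c₂ c₃ K := by
  intro f g h hf hg hh
  have key := hE (f ∘ e) (g ∘ e) (h ∘ e) (hf.comp e.measurable) (hg.comp e.measurable)
    (hh.comp e.measurable)
  have em := e.measurableEmbedding
  simp only [Function.comp_apply, hsub] at key
  rw [he.lintegral_comp_emb em f, he.lintegral_comp_emb em g, he.lintegral_comp_emb em h,
    he.lintegral_comp_emb em (fun y => ∫⁻ x, f (e x) ^ c₁ * g (y - e x) ^ c₂ * h y ^ c₃)] at key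
  refine le_of_eq_of_le (lintegral_congr fun y => ?_) key
  rw [he.lintegral_comp_emb em (fun x => f x ^ c₁ * g (y - x) ^ c₂ * h y ^ c₃)]

lemma TrilinearBound.pi {c₁ c₂ c₃ : ℝ} {K : ℝ≥0∞} (h : TrilinearBound ℝ c₁ c₂ c₃ K) (n : ℕ) :
    TrilinearBound (Fin n → ℝ) c₁ c₂ c₃ (K ^ n) := by
  induction n with
  | zero =>
    intro f g h _ _ _
    have hv : volume (univ : Set (Fin 0 → ℝ)) = 1 := by
      rw [volume_pi, Measure.pi_of_empty]
      exact Measure.dirac_apply_of_mem (mem_univ _)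
    simp only [lintegral_unique, hv, mul_one, pow_zero, one_mul]
    refine le_of_eq ?_
    congr 4
    exact Subsingleton.elim _ _
  | succ n ih =>
    rw [pow_succ']
    exact (h.prod ih).of_measurePreserving (MeasurableEquiv.piFinSuccAbove (fun _ => ℝ) 0).symm
      (volume_preserving_piFinSuccAbove (fun _ => ℝ) 0).symm fun x y => by
        ext i
        refine Fin.cases ?_ (fun j => ?_) i <;> simp [MeasurableEquiv.piFinSuccAbove]

/-- The sharp trilinear Young inequality on Euclidean space. -/
lemma trilinearBound_euclideanSpace {w₁ w₂ w₃ : ℝ} (h₁ : 0 < w₁) (h₂ : 0 < w₂) (h₃ : 0 < w₃)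
    (hw : w₁ + w₂ + w₃ = 1) (D : ℕ) :
    TrilinearBound (EuclideanSpace ℝ (Fin D)) (1 - w₁) (1 - w₂) (1 - w₃)
      (ENNReal.ofReal (youngConst w₁ w₂ w₃) ^ D) :=
  ((trilinearBound_real h₁ h₂ h₃ hw).pi D).of_measurePreserving
    (MeasurableEquiv.toLp 2 (Fin D → ℝ)) (PiLp.volume_preserving_toLp (Fin D)) fun _ _ => rfl

/-! ### Young's convolution inequality -/

/-- Sharp Young inequality in convolution form, obtained by testing the trilinear inequality
against truncations of a power of the convolution. -/
lemma TrilinearBound.lintegral_lconvolution_rpow_le {E : Type*} [AddCommGroup E] [MeasureSpace E]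
    [MeasurableAdd₂ E] [MeasurableNeg E] [MeasurableSub₂ E] [SigmaFinite (volume : Measure E)]
    {c₁ c₂ r : ℝ} {K : ℝ≥0∞} (h₁ : 0 < c₁) (h₂ : 0 < c₂) (hr : 1 < r)
    (hE : TrilinearBound E c₁ c₂ (1 - 1 / r) K) {f g : E → ℝ≥0∞} (hf : Measurable f)
    (hg : Measurable g) :
    (∫⁻ y, (f ⋆ₗ g) y ^ r) ^ (1 / r) ≤
      K * ((∫⁻ x, f x ^ (1 / c₁)) ^ c₁ * (∫⁻ x, g x ^ (1 / c₂)) ^ c₂) := by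
  have hr0 : 0 < r := by linarith
  set u := f ⋆ₗ g with hu
  have hum : Measurable u := measurable_lconvolution _ hf hg
  set R := K * ((∫⁻ x, f x ^ (1 / c₁)) ^ c₁ * (∫⁻ x, g x ^ (1 / c₂)) ^ c₂) with hR
  set v : ℕ → E → ℝ≥0∞ := fun n => (spanningSets volume n).indicator fun y => min (u y) n with hv
  have hvm : ∀ n, Measurable (v n) := fun n =>
    (hum.min measurable_const).indicator (measurableSet_spanningSets _ _)
  have hvu : ∀ n y, v n y ≤ u y := fun n y =>
    (indicator_le_self' (fun _ _ => zero_le) y).trans (min_le_left _ _)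
  have hmono : Monotone v := fun m n hmn y => by
    simp only [hv]
    refine (indicator_le_indicator_of_subset (monotone_spanningSets _ hmn)
      (fun _ => zero_le) y).trans (indicator_le_indicator ?_)
    exact min_le_min_left _ (Nat.cast_le.2 hmn)
  have hsup : ∀ y, ⨆ n, v n y = u y := fun y => by
    refine le_antisymm (iSup_le fun n => hvu n y) (le_of_forall_lt fun b hb => ?_)
    obtain ⟨m, hm⟩ := ENNReal.exists_nat_gt hb.ne_top
    obtain ⟨k, hk⟩ := mem_iUnion.1 ((iUnion_spanningSets (volume : Measure E)).ge (mem_univ y))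
    refine lt_iSup_iff.2 ⟨max m k, ?_⟩
    simp only [hv]
    rw [indicator_of_mem (monotone_spanningSets _ (le_max_right m k) hk)]
    exact lt_min hb (hm.trans_le (Nat.cast_le.2 (le_max_left m k)))
  have hfin : ∀ n, ∫⁻ y, v n y ^ r ≠ ∞ := fun n => by
    have : ∀ y, v n y ^ r ≤ (spanningSets volume n).indicator (fun _ => (n : ℝ≥0∞) ^ r) y := by
      intro y
      by_cases hy : y ∈ spanningSets volume n
      · simp only [hv, indicator_of_mem hy]
        exact ENNReal.rpow_le_rpow (min_le_right _ _) hr0.le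
      · simp only [hv, indicator_of_notMem hy, ENNReal.zero_rpow_of_pos hr0, le_refl]
    refine ((lintegral_mono this).trans_lt ?_).ne
    rw [lintegral_indicator (measurableSet_spanningSets _ _), setLIntegral_const]
    exact ENNReal.mul_lt_top (ENNReal.rpow_lt_top_of_nonneg hr0.le (ENNReal.natCast_ne_top n))
      (measure_spanningSets_lt_top _ _)
  have hc : (1 - 1 / r) * r = r - 1 := by field_simp
  have hstep : ∀ n, ∫⁻ y, v n y ^ r ≤ R ^ r := fun n => by
    set J := ∫⁻ y, v n y ^ r with hJ
    by_cases hJ0 : J = 0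
    · rw [hJ0]; exact zero_le
    have key := hE (fun x => f x ^ (1 / c₁)) (fun x => g x ^ (1 / c₂)) (fun y => v n y ^ r)
      (hf.pow_const _) (hg.pow_const _) ((hvm n).pow_const _)
    have e₁ : ∀ a : ℝ≥0∞, (a ^ (1 / c₁)) ^ c₁ = a := fun a => by
      rw [← ENNReal.rpow_mul, one_div_mul_cancel h₁.ne', ENNReal.rpow_one]
    have e₂ : ∀ a : ℝ≥0∞, (a ^ (1 / c₂)) ^ c₂ = a := fun a => by
      rw [← ENNReal.rpow_mul, one_div_mul_cancel h₂.ne', ENNReal.rpow_one]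
    have e₃ : ∀ a : ℝ≥0∞, (a ^ r) ^ (1 - 1 / r) = a ^ (r - 1) := fun a => by
      rw [← ENNReal.rpow_mul, mul_comm, hc]
    simp only [e₁, e₂, e₃] at key
    have hlow : J ≤ R * J ^ (1 - 1 / r) := by
      calc J ≤ ∫⁻ y, u y * v n y ^ (r - 1) := lintegral_mono fun y => by
            calc v n y ^ r = v n y ^ ((1 : ℝ) + (r - 1)) := by ring_nf
              _ = v n y ^ (1 : ℝ) * v n y ^ (r - 1) :=
                ENNReal.rpow_add_of_nonneg _ _ zero_le_one (by linarith)
              _ ≤ _ := by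
                rw [ENNReal.rpow_one]
                exact mul_le_mul_left (hvu n y) _
        _ = ∫⁻ y, ∫⁻ x, f x * g (y - x) * v n y ^ (r - 1) := lintegral_congr fun y => by
            have hm : Measurable fun x => f x * g (y - x) :=
              hf.mul (hg.comp (measurable_const.sub measurable_id))
            rw [lintegral_mul_const _ hm, hu, lconvolution_def]
            simp only [neg_add_eq_sub]
        _ ≤ _ := key.trans_eq (by rw [hR]; ring)
    have hJr : J ^ (1 / r) ≤ R := by
      have hJc0 : J ^ (1 - 1 / r) ≠ 0 := by
        simp [ENNReal.rpow_eq_zero_iff, hJ0, hJ ▸ hfin n]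
      have hJcT : J ^ (1 - 1 / r) ≠ ∞ :=
        (ENNReal.rpow_lt_top_of_nonneg (by rw [sub_nonneg, div_le_one hr0]; exact hr.le)
          (hfin n)).ne
      have hsplit : J = J ^ (1 / r) * J ^ (1 - 1 / r) := by
        rw [← ENNReal.rpow_add _ _ hJ0 (hfin n), add_sub_cancel, ENNReal.rpow_one]
      exact (ENNReal.mul_le_mul_iff_left hJc0 hJcT).1 (hsplit.symm.trans_le hlow)
    calc J = (J ^ (1 / r)) ^ r := by
          rw [← ENNReal.rpow_mul, one_div_mul_cancel hr0.ne', ENNReal.rpow_one]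
      _ ≤ R ^ r := ENNReal.rpow_le_rpow hJr hr0.le
  have hlim : ∫⁻ y, u y ^ r = ⨆ n, ∫⁻ y, v n y ^ r := by
    rw [← lintegral_iSup (fun n => (hvm n).pow_const _)
      (fun m n hmn y => ENNReal.rpow_le_rpow (hmono hmn y) hr0.le)]
    refine lintegral_congr fun y => ?_
    rw [← hsup y]
    exact (ENNReal.orderIsoRpow r hr0).map_iSup _
  calc (∫⁻ y, u y ^ r) ^ (1 / r) ≤ (R ^ r) ^ (1 / r) :=
        ENNReal.rpow_le_rpow (hlim ▸ iSup_le hstep) (by positivity)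
    _ = R := by rw [← ENNReal.rpow_mul, mul_one_div_cancel hr0.ne', ENNReal.rpow_one]

/-! ### Rényi entropy powers -/

section RenyiPower

variable {Ω : Type*} [MeasurableSpace Ω] {D : ℕ}

lemma renyiEntropyPower_eq_lintegral {p : ℝ} (hp : 1 < p) (X : Ω → EuclideanSpace ℝ (Fin D))
    (P : Measure Ω) :
    renyiEntropyPower p X P = ENNReal.ofReal ((2 * Real.pi)⁻¹ * p ^ (-(1 / (p - 1)))) *
      (∫⁻ x, pdf X P volume x ^ p) ^ (-(2 / (D * (p - 1)))) := by
  have hp0 : 0 < p := by linarith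
  have hp1 : p - 1 ≠ 0 := by linarith
  unfold renyiEntropyPower Real.conjExponent
  rw [eLpNorm_eq_lintegral_rpow_enorm_toReal (by simpa using hp0) ENNReal.ofReal_ne_top,
    ENNReal.toReal_ofReal hp0.le, ← ENNReal.rpow_mul]
  simp only [enorm_eq_self]
  congr 3
  · congr 1
    field_simp
  · rcases eq_or_ne (D : ℝ) 0 with hD | hD
    · simp [hD]
    · field_simp

/-- The Rényi entropy power is an exponential of the Rényi entropy. -/
lemma renyiEntropyPower_eq_exp {p : ℝ} (hp : 1 < p) (X : Ω → EuclideanSpace ℝ (Fin D))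
    (P : Measure Ω) :
    renyiEntropyPower p X P = ENNReal.ofReal ((2 * Real.pi)⁻¹ * p ^ (-(1 / (p - 1)))) *
      EReal.exp (((2 / D : ℝ) : EReal) * renyiEntropy p X P) := by
  rw [renyiEntropyPower_eq_lintegral hp, ENNReal.rpow_eq_exp_mul_log, renyiEntropy, ← mul_assoc,
    ← EReal.coe_mul]
  congr 4
  rw [← neg_sub p 1, div_neg, mul_neg, div_mul_div_comm, mul_one]

lemma EReal.coe_mul_injective {a : ℝ} (ha : a ≠ 0) :
    Function.Injective fun x : EReal => (a : EReal) * x := by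
  refine Function.LeftInverse.injective (g := fun x => ((a⁻¹ : ℝ) : EReal) * x) fun x => ?_
  simp only
  rw [← mul_assoc, ← EReal.coe_mul, inv_mul_cancel₀ ha, EReal.coe_one, one_mul]

/-- The entropy and the entropy power of a fixed order determine each other. -/
lemma renyiEntropy_eq_iff_renyiEntropyPower_eq {Ω' : Type*} [MeasurableSpace Ω'] (hD : 0 < D)
    {p : ℝ} (hp : 1 < p) (X : Ω → EuclideanSpace ℝ (Fin D)) (P : Measure Ω)
    (Y : Ω' → EuclideanSpace ℝ (Fin D)) (P' : Measure Ω') :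
    renyiEntropy p X P = renyiEntropy p Y P' ↔
      renyiEntropyPower p X P = renyiEntropyPower p Y P' := by
  have hp0 : 0 < p := by linarith
  have hc : 0 < (2 * Real.pi)⁻¹ * p ^ (-(1 / (p - 1))) := by positivity
  have hD' : (2 / D : ℝ) ≠ 0 := by positivity
  rw [renyiEntropyPower_eq_exp hp, renyiEntropyPower_eq_exp hp,
    ENNReal.mul_right_inj (ENNReal.ofReal_pos.2 hc).ne' ENNReal.ofReal_ne_top,
    EReal.exp_strictMono.injective.eq_iff, (EReal.coe_mul_injective hD').eq_iff]

lemma lintegral_pdf {P : Measure Ω} [IsProbabilityMeasure P] {X : Ω → EuclideanSpace ℝ (Fin D)}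
    (hX : HasPDF X P volume) : ∫⁻ x, pdf X P volume x = 1 := by
  rw [pdf.lintegral_eq_measure_univ, measure_univ]

lemma lintegral_pdf_rpow_ne_zero {P : Measure Ω} [IsProbabilityMeasure P]
    {X : Ω → EuclideanSpace ℝ (Fin D)} (hX : HasPDF X P volume) {p : ℝ} (hp : 0 < p) :
    ∫⁻ x, pdf X P volume x ^ p ≠ 0 := by
  intro h
  have hm : Measurable (pdf X P volume) := measurable_pdf X P volume
  rw [lintegral_eq_zero_iff (hm.pow_const p)] at h
  have h0 : pdf X P volume =ᵐ[volume] 0 := by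
    filter_upwards [h] with x hx
    simpa [ENNReal.rpow_eq_zero_iff, hp, hp.not_gt] using hx
  have := lintegral_pdf hX
  rw [lintegral_congr_ae h0] at this
  simp at this

lemma memLp_pdf_iff_lintegral {P : Measure Ω} {X : Ω → EuclideanSpace ℝ (Fin D)} {p : ℝ}
    (hp : 0 < p) :
    MemLp (pdf X P volume) (ENNReal.ofReal p) volume ↔ ∫⁻ x, pdf X P volume x ^ p ≠ ∞ := by
  have hm : Measurable (pdf X P volume) := measurable_pdf X P volume
  have h : eLpNorm (pdf X P volume) (ENNReal.ofReal p) volume =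
      (∫⁻ x, pdf X P volume x ^ p) ^ (1 / p) := by
    rw [eLpNorm_eq_lintegral_rpow_enorm_toReal (by simpa using hp) ENNReal.ofReal_ne_top,
      ENNReal.toReal_ofReal hp.le]
    simp only [enorm_eq_self]
  rw [← lt_top_iff_ne_top, MemLp, h]
  simp only [hm.aestronglyMeasurable, true_and]
  exact ENNReal.rpow_lt_top_iff_of_pos (by positivity)

lemma renyiEntropyPower_pos_lt_top {P : Measure Ω} [IsProbabilityMeasure P]
    {X : Ω → EuclideanSpace ℝ (Fin D)} (hX : HasPDF X P volume) {p : ℝ} (hp : 1 < p)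
    (h : MemLp (pdf X P volume) (ENNReal.ofReal p) volume) :
    0 < renyiEntropyPower p X P ∧ renyiEntropyPower p X P < ∞ := by
  have hp0 : 0 < p := by linarith
  have hc : 0 < (2 * Real.pi)⁻¹ * p ^ (-(1 / (p - 1))) := by positivity
  have h0 := lintegral_pdf_rpow_ne_zero hX hp0
  have hT := (memLp_pdf_iff_lintegral hp0).1 h
  rw [renyiEntropyPower_eq_lintegral hp]
  exact ⟨ENNReal.mul_pos (ENNReal.ofReal_pos.2 hc).ne' (ENNReal.rpow_pos h0.bot_lt hT).ne',
    ENNReal.mul_lt_top ENNReal.ofReal_lt_top (ENNReal.rpow_ne_top_of_ne_zero h0 hT).lt_top⟩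

end RenyiPower

/-! ### Gaussian random vectors -/

lemma lintegral_fin_prod_eq_prod {n : ℕ} {f : Fin n → ℝ → ℝ≥0∞} (hf : ∀ i, Measurable (f i)) :
    ∫⁻ x : Fin n → ℝ, ∏ i, f i (x i) = ∏ i, ∫⁻ t, f i t := by
  induction n with
  | zero =>
    have hv : volume (univ : Set (Fin 0 → ℝ)) = 1 := by
      rw [volume_pi, Measure.pi_of_empty]
      exact Measure.dirac_apply_of_mem (mem_univ _)
    simp [hv]
  | succ n ih =>
    have e := (volume_preserving_piFinSuccAbove (fun _ : Fin (n + 1) => ℝ) 0).symm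
    rw [← e.lintegral_comp_emb (MeasurableEquiv.measurableEmbedding _)]
    have h2 : Measurable fun y : Fin n → ℝ => ∏ i : Fin n, f i.succ (y i) :=
      Finset.measurable_prod _ fun i _ => (hf _).comp (measurable_pi_apply i)
    simp only [Fin.prod_univ_succ]
    have hs : ∀ z : ℝ × (Fin n → ℝ),
        f 0 ((MeasurableEquiv.piFinSuccAbove (fun _ => ℝ) 0).symm z 0) *
        ∏ i : Fin n, f i.succ ((MeasurableEquiv.piFinSuccAbove (fun _ => ℝ) 0).symm z i.succ) =
        f 0 z.1 * ∏ i : Fin n, f i.succ (z.2 i) := fun z => by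
      simp [MeasurableEquiv.piFinSuccAbove]
    simp_rw [hs]
    rw [Measure.volume_eq_prod, lintegral_prod_mul (hf 0).aemeasurable h2.aemeasurable,
      ih fun i => hf i.succ]

lemma pi_withDensity_fin {n : ℕ} {f : Fin n → ℝ → ℝ≥0∞} (hf : ∀ i, Measurable (f i))
    [∀ i, SigmaFinite ((volume : Measure ℝ).withDensity (f i))] :
    Measure.pi (fun i => (volume : Measure ℝ).withDensity (f i)) =
      (volume : Measure (Fin n → ℝ)).withDensity fun x => ∏ i, f i (x i) := by
  refine Measure.pi_eq fun s hs => ?_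
  rw [withDensity_apply _ (MeasurableSet.univ_pi hs), ← lintegral_indicator
    (MeasurableSet.univ_pi hs)]
  have h1 : ∀ x : Fin n → ℝ, (univ.pi s).indicator (fun x => ∏ i, f i (x i)) x =
      ∏ i, (s i).indicator (f i) (x i) := fun x => by
    by_cases hx : x ∈ univ.pi s
    · rw [indicator_of_mem hx]
      exact Finset.prod_congr rfl fun i _ => (indicator_of_mem (hx i (mem_univ i)) _).symm
    · rw [indicator_of_notMem hx]
      simp only [Set.mem_pi, mem_univ, true_implies, not_forall] at hx
      obtain ⟨i, hi⟩ := hx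
      exact (Finset.prod_eq_zero (Finset.mem_univ i) (indicator_of_notMem hi _)).symm
  simp_rw [h1]
  rw [lintegral_fin_prod_eq_prod fun i => (hf i).indicator (hs i)]
  refine Finset.prod_congr rfl fun i _ => ?_
  rw [lintegral_indicator (hs i), withDensity_apply _ (hs i)]

/-- The law of `√N • Z` for a standard Gaussian `Z` has the product Gaussian density. -/
lemma map_smul_stdGaussian_eq_withDensity (D : ℕ) {N : NNReal} (hN : N ≠ 0) :
    (stdGaussian (EuclideanSpace ℝ (Fin D))).map (fun x => √(N : ℝ) • x) =
      volume.withDensity fun x => ∏ i, gaussianPDF 0 N (x i) := by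
  have e : MeasurePreserving (MeasurableEquiv.toLp 2 (Fin D → ℝ)) :=
    PiLp.volume_preserving_toLp (Fin D)
  have hscale : (gaussianReal 0 1).map (fun t => √(N : ℝ) * t) = gaussianReal 0 N := by
    rw [gaussianReal_map_const_mul]
    congr 1
    · simp
    · ext
      simp
  have hpi : (Measure.pi fun _ : Fin D => gaussianReal 0 1).map (fun x => √(N : ℝ) • x) =
      Measure.pi fun _ : Fin D => gaussianReal 0 N := by
    have := Measure.pi_map_pi (μ := fun _ : Fin D => gaussianReal 0 1)
      (f := fun _ t => √(N : ℝ) * t) (hμ := fun i => by rw [hscale]; infer_instance)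
      (fun i => by fun_prop)
    rw [hscale] at this
    exact this
  have hcomp : (stdGaussian (EuclideanSpace ℝ (Fin D))).map (fun x => √(N : ℝ) • x) =
      (Measure.pi fun _ : Fin D => gaussianReal 0 N).map (MeasurableEquiv.toLp 2 (Fin D → ℝ)) := by
    rw [← hpi, ← map_pi_eq_stdGaussian, Measure.map_map (by fun_prop) (by fun_prop),
      Measure.map_map (MeasurableEquiv.measurable _) (by fun_prop)]
    rfl
  have hd : gaussianReal 0 N = volume.withDensity (gaussianPDF 0 N) :=
    gaussianReal_of_var_ne_zero 0 hN
  have hpd : (Measure.pi fun _ : Fin D => gaussianReal 0 N) =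
      (volume : Measure (Fin D → ℝ)).withDensity fun x => ∏ i, gaussianPDF 0 N (x i) := by
    have hσ : SigmaFinite ((volume : Measure ℝ).withDensity (gaussianPDF 0 N)) :=
      hd ▸ inferInstance
    rw [hd]
    exact pi_withDensity_fin fun _ => measurable_gaussianPDF 0 N
  rw [hcomp, hpd]
  ext s hs
  rw [Measure.map_apply (MeasurableEquiv.measurable _) hs,
    withDensity_apply _ (MeasurableEquiv.measurable _ hs), withDensity_apply _ hs,
    ← e.setLIntegral_comp_preimage_emb (MeasurableEquiv.measurableEmbedding _)]
  rfl

lemma lintegral_gaussianPDF_rpow {N : NNReal} (hN : N ≠ 0) {p : ℝ} (hp : 0 < p) :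
    ∫⁻ t, gaussianPDF 0 N t ^ p =
      ENNReal.ofReal ((√(2 * Real.pi * N))⁻¹ ^ p * √(2 * Real.pi * N / p)) := by
  have hN0 : (0 : ℝ) < N := NNReal.coe_pos.2 (pos_iff_ne_zero.2 hN)
  have h : ∀ t, gaussianPDF 0 N t ^ p = ENNReal.ofReal ((√(2 * Real.pi * N))⁻¹ ^ p) *
      ENNReal.ofReal (Real.exp (-(p / (2 * N)) * t ^ 2)) := fun t => by
    rw [gaussianPDF, ENNReal.ofReal_rpow_of_nonneg (gaussianPDFReal_nonneg _ _ _) hp.le,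
      gaussianPDFReal, Real.mul_rpow (by positivity) (Real.exp_pos _).le, ← Real.exp_mul,
      ENNReal.ofReal_mul (by positivity)]
    congr 3
    ring
  simp_rw [h]
  rw [lintegral_const_mul _ (by fun_prop), lintegral_exp_neg_mul_sq (by positivity),
    ← ENNReal.ofReal_mul (by positivity)]
  congr 3
  field_simp

/-- The normalisation of the Rényi entropy power: a centred Gaussian vector with covariance
`N • 1` has entropy power `N` for every order. -/
lemma renyiEntropyPower_smul_stdGaussian {Ω : Type*} [MeasurableSpace Ω] {D : ℕ} (hD : 0 < D)
    {P : Measure Ω} {Z : Ω → EuclideanSpace ℝ (Fin D)}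
    (hZ : HasLaw Z (stdGaussian (EuclideanSpace ℝ (Fin D))) P) {N p : ℝ} (hN : 0 < N)
    (hp : 1 < p) :
    renyiEntropyPower p (fun ω => √N • Z ω) P = ENNReal.ofReal N := by
  lift N to NNReal using hN.le
  have hN' : N ≠ 0 := (NNReal.coe_pos.1 hN).ne'
  have hp0 : 0 < p := by linarith
  have hp1 : 0 < p - 1 := by linarith
  have hD0 : (0 : ℝ) < D := Nat.cast_pos.2 hD
  have hmap : P.map (fun ω => √(N : ℝ) • Z ω) =
      volume.withDensity fun x => ∏ i, gaussianPDF 0 N (x i) := by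
    rw [← map_smul_stdGaussian_eq_withDensity D hN', ← hZ.map_eq,
      AEMeasurable.map_map_of_aemeasurable (by fun_prop) hZ.aemeasurable]
    rfl
  have hgm : Measurable fun x : EuclideanSpace ℝ (Fin D) => ∏ i, gaussianPDF 0 N (x i) := by
    fun_prop
  have : IsProbabilityMeasure P := hZ.isProbabilityMeasure_iff.2 inferInstance
  have hpdf : HasPDF (fun ω => √(N : ℝ) • Z ω) P volume :=
    hasPDF_of_map_eq_withDensity (hZ.aemeasurable.const_smul √(N : ℝ)) _ hgm.aemeasurable hmap
  have hae := (pdf.eq_of_map_eq_withDensity' (X := fun ω => √(N : ℝ) • Z ω) _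
    hgm.aemeasurable).1 hmap
  set B : ℝ := (√(2 * Real.pi * N))⁻¹ ^ p * √(2 * Real.pi * N / p) with hB
  have hBpos : 0 < B := by positivity
  have hint : ∫⁻ x, pdf (fun ω => √(N : ℝ) • Z ω) P volume x ^ p = ENNReal.ofReal B ^ D := by
    have h1 : ∫⁻ x, pdf (fun ω => √(N : ℝ) • Z ω) P volume x ^ p =
        ∫⁻ x : EuclideanSpace ℝ (Fin D), ∏ i, gaussianPDF 0 N (x i) ^ p := by
      refine lintegral_congr_ae ?_
      filter_upwards [hae] with x hx
      rw [hx, ENNReal.prod_rpow_of_nonneg hp0.le]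
    rw [h1, ← (PiLp.volume_preserving_toLp (Fin D)).lintegral_comp_emb
      (MeasurableEquiv.toLp 2 (Fin D → ℝ)).measurableEmbedding]
    simp only
    rw [lintegral_fin_prod_eq_prod fun _ => (measurable_gaussianPDF 0 N).pow_const p]
    simp [lintegral_gaussianPDF_rpow hN' hp0, hB]
  rw [renyiEntropyPower_eq_lintegral hp, hint, ← ENNReal.rpow_natCast, ← ENNReal.rpow_mul,
    ENNReal.ofReal_rpow_of_pos hBpos, ← ENNReal.ofReal_mul (by positivity)]
  congr 1
  refine Real.log_injOn_pos (mem_Ioi.2 (by positivity)) (mem_Ioi.2 hN) ?_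
  have hπ := Real.pi_pos
  have hBlog : Real.log B = p * -((Real.log (2 * Real.pi) + Real.log N) / 2) +
      (Real.log (2 * Real.pi) + Real.log N - Real.log p) / 2 := by
    rw [hB, Real.log_mul (by positivity) (by positivity), Real.log_rpow (by positivity),
      Real.log_inv, Real.log_sqrt (by positivity), Real.log_sqrt (by positivity),
      Real.log_div (by positivity) hp0.ne', Real.log_mul (by positivity) hN.ne']
  rw [Real.log_mul (by positivity) (by positivity),
    Real.log_mul (by positivity) (Real.rpow_pos_of_pos hp0 _).ne', Real.log_inv,
    Real.log_rpow hp0, Real.log_rpow hBpos, hBlog]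
  field_simp
  ring

/-! ### The Rényi entropy power inequality -/

/-- The constants in the definition of the Rényi entropy power and in the sharp Young inequality
match: this is the entropy power inequality with equality, written for the two norms
`a ^ (1 / q)` and `b ^ (1 / p)`. -/
lemma weighted_entropyPower_eq_young {D : ℕ} (hD : 0 < D) {r t a b : ℝ} (hr : 1 < r)
    (ht0 : 0 < t) (ht1 : t < 1) (ha : 0 < a) (hb : 0 < b) {q p : ℝ}
    (hq : q = r / ((1 - t) + t * r)) (hp : p = r / (t + (1 - t) * r)) :
    ((2 * Real.pi)⁻¹ * q ^ (-(1 / (q - 1))) * a ^ (-(2 / (D * (q - 1)))) / (1 - t)) ^ (1 - t) *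
        ((2 * Real.pi)⁻¹ * p ^ (-(1 / (p - 1))) * b ^ (-(2 / (D * (p - 1)))) / t) ^ t =
      (2 * Real.pi)⁻¹ * r ^ (-(1 / (r - 1))) *
        (youngConst ((1 - t) * (1 - 1 / r)) (t * (1 - 1 / r)) (1 / r) ^ D *
          (a ^ (1 / q) * b ^ (1 / p))) ^ (-(2 * r / (D * (r - 1)))) := by
  have hr0 : 0 < r := by linarith
  have hr1 : 0 < r - 1 := by linarith
  have hs : 0 < 1 - t := by linarith
  have hD0 : (0 : ℝ) < D := Nat.cast_pos.2 hD
  have hπ := Real.pi_pos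
  have hu : 0 < (1 - t) + t * r := by positivity
  have hv : 0 < t + (1 - t) * r := by positivity
  have hq0 : 0 < q := hq ▸ div_pos hr0 hu
  have hp0 : 0 < p := hp ▸ div_pos hr0 hv
  have hq1 : q - 1 = (1 - t) * (r - 1) / ((1 - t) + t * r) := by
    rw [hq]; field_simp; ring
  have hp1 : p - 1 = t * (r - 1) / (t + (1 - t) * r) := by
    rw [hp]; field_simp; ring
  have hlq : Real.log q = Real.log r - Real.log ((1 - t) + t * r) := by
    rw [hq, Real.log_div hr0.ne' hu.ne']
  have hlp : Real.log p = Real.log r - Real.log (t + (1 - t) * r) := by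
    rw [hp, Real.log_div hr0.ne' hv.ne']
  have e₃ : 1 - 1 / r = (r - 1) / r := by field_simp
  have e₁ : 1 - (1 - t) * ((r - 1) / r) = ((1 - t) + t * r) / r := by field_simp; ring
  have e₂ : 1 - t * ((r - 1) / r) = (t + (1 - t) * r) / r := by field_simp; ring
  set K := youngConst ((1 - t) * (1 - 1 / r)) (t * (1 - 1 / r)) (1 / r) with hK
  have hKpos : 0 < K := youngConst_pos (by rw [e₃]; positivity) (by rw [e₃]; positivity)
    (by positivity) (by field_simp; ring)
  have hlK : Real.log K =
      ((1 - t) * ((r - 1) / r) * (Real.log (1 - t) + (Real.log (r - 1) - Real.log r)) -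
        ((1 - t) + t * r) / r * (Real.log ((1 - t) + t * r) - Real.log r) +
       (t * ((r - 1) / r) * (Real.log t + (Real.log (r - 1) - Real.log r)) -
        (t + (1 - t) * r) / r * (Real.log (t + (1 - t) * r) - Real.log r)) +
       (1 / r * (-Real.log r) - (r - 1) / r * (Real.log (r - 1) - Real.log r))) / 2 := by
    rw [hK, youngConst, e₃, e₁, e₂]
    have f₁ : 0 < (1 - t) * ((r - 1) / r) := by positivity
    have f₂ : 0 < t * ((r - 1) / r) := by positivity
    have f₃ : 0 < 1 / r := by positivity
    have g₁ : 0 < ((1 - t) + t * r) / r := by positivity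
    have g₂ : 0 < (t + (1 - t) * r) / r := by positivity
    have g₃ : 0 < (r - 1) / r := by positivity
    have k : ∀ {x y : ℝ}, 0 < x → 0 < y →
        0 < x ^ x / y ^ y ∧ Real.log (x ^ x / y ^ y) = x * Real.log x - y * Real.log y :=
      fun hx hy => ⟨by positivity, by
        rw [Real.log_div (by positivity) (by positivity), Real.log_rpow hx, Real.log_rpow hy]⟩
    rw [Real.log_sqrt (by
      exact (mul_pos (mul_pos (k f₁ g₁).1 (k f₂ g₂).1) (k f₃ g₃).1).le),
      Real.log_mul (mul_pos (k f₁ g₁).1 (k f₂ g₂).1).ne' (k f₃ g₃).1.ne',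
      Real.log_mul (k f₁ g₁).1.ne' (k f₂ g₂).1.ne', (k f₁ g₁).2, (k f₂ g₂).2, (k f₃ g₃).2,
      Real.log_mul hs.ne' g₃.ne', Real.log_mul ht0.ne' g₃.ne', Real.log_div hr1.ne' hr0.ne',
      Real.log_div hu.ne' hr0.ne', Real.log_div hv.ne' hr0.ne', Real.log_div one_ne_zero hr0.ne',
      Real.log_one, zero_sub]
  have k : ∀ {m c u : ℝ}, 0 < m → 0 < c → 0 < u →
      0 < (2 * Real.pi)⁻¹ * m ^ (-(1 / (m - 1))) * c ^ (-(2 / (D * (m - 1)))) / u ∧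
      Real.log ((2 * Real.pi)⁻¹ * m ^ (-(1 / (m - 1))) * c ^ (-(2 / (D * (m - 1)))) / u) =
        -Real.log (2 * Real.pi) + -(1 / (m - 1)) * Real.log m +
          -(2 / (D * (m - 1))) * Real.log c - Real.log u := fun hm hc hu =>
    ⟨by positivity, by
      rw [Real.log_div (by positivity) hu.ne', Real.log_mul (by positivity) (by positivity),
        Real.log_mul (by positivity) (Real.rpow_pos_of_pos hm _).ne', Real.log_inv,
        Real.log_rpow hm, Real.log_rpow hc]⟩
  obtain ⟨x₁, y₁⟩ := k hq0 ha hs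
  obtain ⟨x₂, y₂⟩ := k hp0 hb ht0
  have hab : 0 < K ^ D * (a ^ (1 / q) * b ^ (1 / p)) := by positivity
  refine Real.log_injOn_pos (mem_Ioi.2 (mul_pos (Real.rpow_pos_of_pos x₁ _)
    (Real.rpow_pos_of_pos x₂ _))) (mem_Ioi.2 (by positivity)) ?_
  have hright : Real.log ((2 * Real.pi)⁻¹ * r ^ (-(1 / (r - 1))) *
        (K ^ D * (a ^ (1 / q) * b ^ (1 / p))) ^ (-(2 * r / (D * (r - 1))))) =
      -Real.log (2 * Real.pi) + -(1 / (r - 1)) * Real.log r + -(2 * r / (D * (r - 1))) *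
        (D * Real.log K + (1 / q * Real.log a + 1 / p * Real.log b)) := by
    rw [Real.log_mul (by positivity) (Real.rpow_pos_of_pos hab _).ne',
      Real.log_mul (by positivity) (Real.rpow_pos_of_pos hr0 _).ne', Real.log_inv,
      Real.log_rpow hr0, Real.log_rpow hab, Real.log_mul (pow_pos hKpos _).ne' (by positivity),
      Real.log_pow, Real.log_mul (x := a ^ (1 / q)) (by positivity) (by positivity),
      Real.log_rpow ha, Real.log_rpow hb]
  rw [hright, Real.log_mul (Real.rpow_pos_of_pos x₁ _).ne' (Real.rpow_pos_of_pos x₂ _).ne',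
    Real.log_rpow x₁, Real.log_rpow x₂, y₁, y₂, hlK, hq1, hp1, hlq, hlp, hq, hp]
  field_simp
  ring

section RenyiEPI

variable {Ω : Type*} [MeasurableSpace Ω] {D : ℕ} {P : Measure Ω} [IsProbabilityMeasure P]

/-- Sharp Young inequality for the density of a sum of independent random vectors. -/
lemma lintegral_pdf_add_rpow_le {r t : ℝ} {X₁ X₂ : Ω → EuclideanSpace ℝ (Fin D)} (hr : 1 < r)
    (ht0 : 0 < t) (ht1 : t < 1) (hX : IndepFun X₁ X₂ P) (h₁ : HasPDF X₁ P volume)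
    (h₂ : HasPDF X₂ P volume) :
    (∫⁻ x, pdf (X₁ + X₂) P volume x ^ r) ^ (1 / r) ≤
      ENNReal.ofReal (youngConst ((1 - t) * (1 - 1 / r)) (t * (1 - 1 / r)) (1 / r)) ^ D *
        ((∫⁻ x, pdf X₁ P volume x ^ (r / ((1 - t) + t * r))) ^ (1 / (r / ((1 - t) + t * r))) *
          (∫⁻ x, pdf X₂ P volume x ^ (r / (t + (1 - t) * r))) ^
            (1 / (r / (t + (1 - t) * r)))) := by
  have hr0 : 0 < r := by linarith
  have hs : 0 < 1 - t := by linarith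
  have hu : 0 < (1 - t) + t * r := by positivity
  have hv : 0 < t + (1 - t) * r := by positivity
  have hr1 : 0 < 1 - 1 / r := by rw [sub_pos, div_lt_one hr0]; exact hr
  have key := trilinearBound_euclideanSpace (mul_pos hs hr1) (mul_pos ht0 hr1)
    (one_div_pos.2 hr0) (by ring) D
  have e₁ : 1 - (1 - t) * (1 - 1 / r) = ((1 - t) + t * r) / r := by field_simp; ring
  have e₂ : 1 - t * (1 - 1 / r) = (t + (1 - t) * r) / r := by field_simp; ring
  have hy := key.lintegral_lconvolution_rpow_le (by rw [e₁]; positivity) (by rw [e₂]; positivity)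
    hr (measurable_pdf X₁ P volume) (measurable_pdf X₂ P volume)
  rw [e₁, e₂, one_div_div, one_div_div] at hy
  rw [one_div_div, one_div_div]
  refine le_of_eq_of_le (congrArg (· ^ (1 / r)) (lintegral_congr_ae ?_)) hy
  filter_upwards [IndepFun.pdf_add_eq_lconvolution_pdf (μ := volume) hX] with x hx
  rw [hx]

lemma memLp_pdf_add {r t : ℝ} {X₁ X₂ : Ω → EuclideanSpace ℝ (Fin D)} (hr : 1 < r)
    (ht0 : 0 < t) (ht1 : t < 1) (hX : IndepFun X₁ X₂ P) (h₁ : HasPDF X₁ P volume)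
    (h₂ : HasPDF X₂ P volume)
    (m₁ : MemLp (pdf X₁ P volume) (ENNReal.ofReal (r / ((1 - t) + t * r))) volume)
    (m₂ : MemLp (pdf X₂ P volume) (ENNReal.ofReal (r / (t + (1 - t) * r))) volume) :
    MemLp (pdf (X₁ + X₂) P volume) (ENNReal.ofReal r) volume := by
  have hr0 : 0 < r := by linarith
  have hs : 0 < 1 - t := by linarith
  have hu : 0 < (1 - t) + t * r := by positivity
  have hv : 0 < t + (1 - t) * r := by positivity
  have a₁ := (memLp_pdf_iff_lintegral (div_pos hr0 hu)).1 m₁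
  have a₂ := (memLp_pdf_iff_lintegral (div_pos hr0 hv)).1 m₂
  rw [memLp_pdf_iff_lintegral hr0, ← lt_top_iff_ne_top,
    ← ENNReal.rpow_lt_top_iff_of_pos (one_div_pos.2 hr0)]
  refine (lintegral_pdf_add_rpow_le hr ht0 ht1 hX h₁ h₂).trans_lt ?_
  exact ENNReal.mul_lt_top (ENNReal.pow_lt_top ENNReal.ofReal_lt_top)
    (ENNReal.mul_lt_top (ENNReal.rpow_lt_top_of_nonneg (by positivity) a₁)
      (ENNReal.rpow_lt_top_of_nonneg (by positivity) a₂))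

/-- The Rényi entropy power inequality. -/
lemma weightedPowerBound_le_renyiEntropyPower_add (hD : 0 < D) {r t : ℝ}
    {X₁ X₂ : Ω → EuclideanSpace ℝ (Fin D)} (hr : 1 < r) (ht0 : 0 < t) (ht1 : t < 1)
    (hX : IndepFun X₁ X₂ P) (h₁ : HasPDF X₁ P volume) (h₂ : HasPDF X₂ P volume)
    (m₁ : MemLp (pdf X₁ P volume) (ENNReal.ofReal (r / ((1 - t) + t * r))) volume)
    (m₂ : MemLp (pdf X₂ P volume) (ENNReal.ofReal (r / (t + (1 - t) * r))) volume) :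
    weightedPowerBound t (renyiEntropyPower (r / ((1 - t) + t * r)) X₁ P)
      (renyiEntropyPower (r / (t + (1 - t) * r)) X₂ P) ≤ renyiEntropyPower r (X₁ + X₂) P := by
  have hr0 : 0 < r := by linarith
  have hr1 : 0 < r - 1 := by linarith
  have hs : 0 < 1 - t := by linarith
  have hD0 : (0 : ℝ) < D := Nat.cast_pos.2 hD
  have hu : 0 < (1 - t) + t * r := by positivity
  have hv : 0 < t + (1 - t) * r := by positivity
  have hy := lintegral_pdf_add_rpow_le hr ht0 ht1 hX h₁ h₂
  have hq1 : 1 < r / ((1 - t) + t * r) := by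
    rw [one_lt_div hu]; nlinarith
  have hp1 : 1 < r / (t + (1 - t) * r) := by
    rw [one_lt_div hv]; nlinarith
  have hid := fun {a b : ℝ} (ha : 0 < a) (hb : 0 < b) =>
    weighted_entropyPower_eq_young hD hr ht0 ht1 ha hb (q := r / ((1 - t) + t * r))
    (p := r / (t + (1 - t) * r)) (hq := rfl) (hp := rfl)
  set q := r / ((1 - t) + t * r)
  set p := r / (t + (1 - t) * r)
  have hq0 : 0 < q := by linarith
  have hp0 : 0 < p := by linarith
  have a₁ := (memLp_pdf_iff_lintegral hq0).1 m₁
  have a₂ := (memLp_pdf_iff_lintegral hp0).1 m₂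
  have z₁ := lintegral_pdf_rpow_ne_zero h₁ hq0
  have z₂ := lintegral_pdf_rpow_ne_zero h₂ hp0
  rw [renyiEntropyPower_eq_lintegral hq1, renyiEntropyPower_eq_lintegral hp1,
    renyiEntropyPower_eq_lintegral hr]
  set a := (∫⁻ x, pdf X₁ P volume x ^ q).toReal with ha
  set b := (∫⁻ x, pdf X₂ P volume x ^ p).toReal with hb
  have ha0 : 0 < a := ENNReal.toReal_pos z₁ a₁
  have hb0 : 0 < b := ENNReal.toReal_pos z₂ a₂
  rw [← ENNReal.ofReal_toReal a₁, ← ENNReal.ofReal_toReal a₂] at hy ⊢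
  rw [← ha, ← hb] at hy ⊢
  set K := youngConst ((1 - t) * (1 - 1 / r)) (t * (1 - 1 / r)) (1 / r) with hK
  have hKpos : 0 < K := youngConst_pos
    (mul_pos hs (by rw [sub_pos, div_lt_one hr0]; exact hr))
    (mul_pos ht0 (by rw [sub_pos, div_lt_one hr0]; exact hr)) (by positivity) (by ring)
  have hRpos : 0 < K ^ D * (a ^ (1 / q) * b ^ (1 / p)) := by positivity
  rw [← ENNReal.ofReal_pow hKpos.le, ENNReal.ofReal_rpow_of_pos ha0,
    ENNReal.ofReal_rpow_of_pos hb0, ← ENNReal.ofReal_mul (by positivity),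
    ← ENNReal.ofReal_mul (by positivity)] at hy
  unfold weightedPowerBound
  rw [ENNReal.ofReal_rpow_of_pos ha0, ENNReal.ofReal_rpow_of_pos hb0,
    ← ENNReal.ofReal_mul (by positivity), ← ENNReal.ofReal_mul (by positivity),
    ← ENNReal.ofReal_div_of_pos hs, ← ENNReal.ofReal_div_of_pos ht0,
    ENNReal.ofReal_rpow_of_nonneg (by positivity) hs.le,
    ENNReal.ofReal_rpow_of_nonneg (by positivity) ht0.le, ← ENNReal.ofReal_mul (by positivity),
    hid ha0 hb0, ENNReal.ofReal_mul (by positivity)]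
  refine mul_le_mul_right ?_ _
  have hexp : -(2 / (D * (r - 1))) = 1 / r * -(2 * r / (D * (r - 1))) := by field_simp
  rw [hexp, ENNReal.rpow_mul, ← ENNReal.ofReal_rpow_of_pos hRpos, ENNReal.rpow_neg,
    ENNReal.rpow_neg, ENNReal.inv_le_inv]
  exact ENNReal.rpow_le_rpow hy (by positivity)

end RenyiEPI

/-! ### The limit of the Rényi entropy at order one -/

/-- The difference quotient of `p ↦ -u ^ p` at one is at most its limit, by convexity. -/
lemma sub_rpow_div_le_negMulLog {u p : ℝ} (hu : 0 ≤ u) (hp : 1 < p) :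
    (u - u ^ p) / (p - 1) ≤ Real.negMulLog u := by
  have hp1 : 0 < p - 1 := by linarith
  rcases hu.eq_or_lt with rfl | hu
  · simp [Real.zero_rpow (by linarith : p ≠ 0)]
  rw [div_le_iff₀ hp1, Real.negMulLog]
  have h1 := Real.add_one_le_exp (Real.log u * (p - 1))
  rw [← Real.rpow_def_of_pos hu] at h1
  have h2 : u ^ p = u * u ^ (p - 1) := by
    rw [← Real.rpow_one_add' hu.le (by linarith)]; ring_nf
  rw [h2]
  nlinarith

/-- A bound for the opposite difference quotient that is uniform for `p` away from `s`. -/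
lemma rpow_sub_div_le {u p s : ℝ} (hu : 0 ≤ u) (hp : 1 < p) (hps : p < s) :
    (u ^ p - u) / (p - 1) ≤ u ^ s / (s - p) := by
  have hp1 : 0 < p - 1 := by linarith
  have hsp : 0 < s - p := by linarith
  rcases hu.eq_or_lt with rfl | hu
  · simp [Real.zero_rpow (by linarith : p ≠ 0), Real.zero_rpow (by linarith : s ≠ 0)]
  have h1 := Real.add_one_le_exp (Real.log u * (1 - p))
  rw [← Real.rpow_def_of_pos hu] at h1
  have h2 : u = u ^ p * u ^ (1 - p) := by
    rw [← Real.rpow_add hu, add_sub_cancel, Real.rpow_one]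
  have hup : 0 < u ^ p := Real.rpow_pos_of_pos hu p
  calc (u ^ p - u) / (p - 1) ≤ u ^ p * Real.log u := by
        rw [div_le_iff₀ hp1]
        nth_rewrite 2 [h2]
        nlinarith
    _ ≤ u ^ p * (u ^ (s - p) / (s - p)) :=
        mul_le_mul_of_nonneg_left (Real.log_le_rpow_div hu.le hsp) hup.le
    _ = u ^ s / (s - p) := by
        rw [← mul_div_assoc, ← Real.rpow_add hu, add_sub_cancel]

lemma tendsto_sub_rpow_div {u : ℝ} (hu : 0 ≤ u) :
    Tendsto (fun p : ℝ => (u - u ^ p) / (p - 1)) (𝓝[>] 1) (𝓝 (Real.negMulLog u)) := by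
  rcases hu.eq_or_lt with rfl | hu
  · refine (tendsto_congr' ?_).2 (by simpa using tendsto_const_nhds)
    filter_upwards [self_mem_nhdsWithin] with p hp
    rw [Real.zero_rpow (by linarith [mem_Ioi.1 hp]), sub_zero, zero_div]
  have h := (Real.hasStrictDerivAt_const_rpow hu 1).hasDerivAt.tendsto_slope
  rw [Real.rpow_one] at h
  have h2 := (h.mono_left (nhdsWithin_mono 1 (fun p (hp : 1 < p) => hp.ne'))).neg
  rw [Real.negMulLog, neg_mul]
  refine h2.congr fun p => ?_
  rw [slope_def_field, Real.rpow_one, ← neg_div, neg_sub]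

section EntropyIntegrals

variable {α : Type*} [MeasurableSpace α] {μ : Measure α} {g : α → ℝ}

/-- Convergence of the positive parts: they are dominated by their limit, so that Fatou's lemma
suffices, and the limit may be infinite. -/
lemma tendsto_lintegral_sub_rpow (hg : Measurable g) (h0 : ∀ x, 0 ≤ g x) :
    Tendsto (fun p : ℝ => ∫⁻ x, ENNReal.ofReal ((g x - g x ^ p) / (p - 1)) ∂μ) (𝓝[>] 1)
      (𝓝 (∫⁻ x, ENNReal.ofReal (Real.negMulLog (g x)) ∂μ)) := by
  have hm : ∀ p : ℝ, Measurable fun x => ENNReal.ofReal ((g x - g x ^ p) / (p - 1)) :=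
    fun p => by fun_prop
  have hlim : ∀ x, Tendsto (fun p : ℝ => ENNReal.ofReal ((g x - g x ^ p) / (p - 1))) (𝓝[>] 1)
      (𝓝 (ENNReal.ofReal (Real.negMulLog (g x)))) := fun x =>
    ENNReal.tendsto_ofReal (tendsto_sub_rpow_div (h0 x))
  refine tendsto_of_le_liminf_of_limsup_le ?_ ?_
  · calc ∫⁻ x, ENNReal.ofReal (Real.negMulLog (g x)) ∂μ
        = ∫⁻ x, liminf (fun p : ℝ => ENNReal.ofReal ((g x - g x ^ p) / (p - 1))) (𝓝[>] 1) ∂μ :=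
          lintegral_congr fun x => (hlim x).liminf_eq.symm
      _ ≤ _ := lintegral_liminf_le hm
  · refine limsup_le_of_le (by isBoundedDefault) ?_
    filter_upwards [self_mem_nhdsWithin] with p hp
    exact lintegral_mono fun x => ENNReal.ofReal_le_ofReal (sub_rpow_div_le_negMulLog (h0 x) hp)

/-- Convergence of the negative parts, by domination by a multiple of `g ^ s`. -/
lemma tendsto_lintegral_rpow_sub (hg : Measurable g) (h0 : ∀ x, 0 ≤ g x) {s : ℝ} (hs : 1 < s)
    (hgs : ∫⁻ x, ENNReal.ofReal (g x ^ s) ∂μ ≠ ∞) :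
    Tendsto (fun p : ℝ => ∫⁻ x, ENNReal.ofReal ((g x ^ p - g x) / (p - 1)) ∂μ) (𝓝[>] 1)
      (𝓝 (∫⁻ x, ENNReal.ofReal (-Real.negMulLog (g x)) ∂μ)) := by
  refine tendsto_lintegral_filter_of_dominated_convergence
    (fun x => ENNReal.ofReal (2 / (s - 1)) * ENNReal.ofReal (g x ^ s)) ?_ ?_ ?_ ?_
  · exact Eventually.of_forall fun p => by fun_prop
  · have : Ioo 1 ((1 + s) / 2) ∈ 𝓝[>] (1 : ℝ) := Ioo_mem_nhdsGT (by linarith)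
    filter_upwards [this] with p hp
    refine ae_of_all _ fun x => ?_
    have hgx : 0 ≤ g x ^ s := Real.rpow_nonneg (h0 x) s
    rw [← ENNReal.ofReal_mul (div_nonneg zero_le_two (by linarith))]
    refine ENNReal.ofReal_le_ofReal ((rpow_sub_div_le (h0 x) hp.1
      (by linarith [hp.2] : p < s)).trans ?_)
    rw [div_mul_eq_mul_div, div_le_div_iff₀ (by linarith [hp.2]) (by linarith)]
    nlinarith [hp.2]
  · rw [lintegral_const_mul _ (by fun_prop)]
    exact ENNReal.mul_ne_top ENNReal.ofReal_ne_top hgs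
  · refine ae_of_all _ fun x => ENNReal.tendsto_ofReal ?_
    refine (tendsto_sub_rpow_div (h0 x)).neg.congr fun p => ?_
    rw [← neg_div, neg_sub]

lemma lintegral_neg_negMulLog_ne_top (h0 : ∀ x, 0 ≤ g x) {s : ℝ} (hs : 1 < s)
    (hgs : ∫⁻ x, ENNReal.ofReal (g x ^ s) ∂μ ≠ ∞) (hg : Measurable g) :
    ∫⁻ x, ENNReal.ofReal (-Real.negMulLog (g x)) ∂μ ≠ ∞ := by
  have hs1 : 0 < s - 1 := by linarith
  refine ne_top_of_le_ne_top (ENNReal.mul_ne_top (ENNReal.ofReal_ne_top (r := 1 / (s - 1))) hgs) ?_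
  rw [← lintegral_const_mul _ (by fun_prop)]
  refine lintegral_mono fun x => ?_
  rw [← ENNReal.ofReal_mul (by positivity)]
  refine ENNReal.ofReal_le_ofReal ?_
  have h1 := sub_rpow_div_le_negMulLog (h0 x) hs
  have h2 : (g x - g x ^ s) / (s - 1) = g x / (s - 1) - 1 / (s - 1) * g x ^ s := by ring
  have h3 : 0 ≤ g x / (s - 1) := div_nonneg (h0 x) hs1.le
  linarith

/-- `∫ g ^ p = ∫ g + (p - 1) * (M - Q)`, where `Q` and `M` are the integrals of the positive and
negative parts of `(g - g ^ p) / (p - 1)`; stated without subtraction. -/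
lemma lintegral_rpow_add_eq (hg : Measurable g) {p : ℝ} (hp : 1 < p)
    (h0 : ∀ x, 0 ≤ g x) :
    ∫⁻ x, ENNReal.ofReal (g x ^ p) ∂μ +
        ENNReal.ofReal (p - 1) * ∫⁻ x, ENNReal.ofReal ((g x - g x ^ p) / (p - 1)) ∂μ =
      ∫⁻ x, ENNReal.ofReal (g x) ∂μ +
        ENNReal.ofReal (p - 1) * ∫⁻ x, ENNReal.ofReal ((g x ^ p - g x) / (p - 1)) ∂μ := by
  have hp1 : 0 < p - 1 := by linarith
  rw [← lintegral_const_mul _ (by fun_prop), ← lintegral_const_mul _ (by fun_prop),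
    ← lintegral_add_left (by fun_prop), ← lintegral_add_left (by fun_prop)]
  refine lintegral_congr fun x => ?_
  have hgp : 0 ≤ g x ^ p := Real.rpow_nonneg (h0 x) p
  rw [← ENNReal.ofReal_mul hp1.le, ← ENNReal.ofReal_mul hp1.le, mul_div_cancel₀ _ hp1.ne',
    mul_div_cancel₀ _ hp1.ne']
  rcases le_total (g x) (g x ^ p) with h | h
  · rw [ENNReal.ofReal_of_nonpos (sub_nonpos.2 h), add_zero,
      ← ENNReal.ofReal_add (h0 x) (sub_nonneg.2 h), add_sub_cancel]
  · rw [ENNReal.ofReal_of_nonpos (sub_nonpos.2 h), add_zero,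
      ← ENNReal.ofReal_add hgp (sub_nonneg.2 h), add_sub_cancel]

/-- The logarithmic form of the Rényi entropy of a probability density converges to the Shannon
entropy as the order decreases to one. -/
lemma tendsto_log_lintegral_rpow (hg : Measurable g) (h0 : ∀ x, 0 ≤ g x)
    (h1 : ∫⁻ x, ENNReal.ofReal (g x) ∂μ = 1) {s : ℝ} (hs : 1 < s)
    (hgs : ∫⁻ x, ENNReal.ofReal (g x ^ s) ∂μ ≠ ∞) :
    Tendsto (fun p : ℝ => ((1 / (1 - p) : ℝ) : EReal) *
        ENNReal.log (∫⁻ x, ENNReal.ofReal (g x ^ p) ∂μ)) (𝓝[>] 1)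
      (𝓝 (((∫⁻ x, ENNReal.ofReal (Real.negMulLog (g x)) ∂μ : ℝ≥0∞) : EReal) -
        ((∫⁻ x, ENNReal.ofReal (-Real.negMulLog (g x)) ∂μ : ℝ≥0∞) : EReal))) := by
  have hQ := tendsto_lintegral_sub_rpow (μ := μ) hg h0
  have hM := tendsto_lintegral_rpow_sub hg h0 hs hgs
  have hMT := lintegral_neg_negMulLog_ne_top h0 hs hgs hg
  set Q : ℝ → ℝ≥0∞ := fun p => ∫⁻ x, ENNReal.ofReal ((g x - g x ^ p) / (p - 1)) ∂μ
  set M : ℝ → ℝ≥0∞ := fun p => ∫⁻ x, ENNReal.ofReal ((g x ^ p - g x) / (p - 1)) ∂μ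
  set A : ℝ → ℝ≥0∞ := fun p => ∫⁻ x, ENNReal.ofReal (g x ^ p) ∂μ with hA
  set Q₁ := ∫⁻ x, ENNReal.ofReal (Real.negMulLog (g x)) ∂μ
  set M₁ := ∫⁻ x, ENNReal.ofReal (-Real.negMulLog (g x)) ∂μ
  set y : ℝ → ℝ := fun p => (Q p).toReal - (M p).toReal with hy
  -- for orders near one all integrals are finite and `∫ g ^ p = 1 - (p - 1) * y p`
  have hev : ∀ᶠ p in 𝓝[>] (1 : ℝ), 1 < p ∧ Q p ≠ ∞ ∧ M p ≠ ∞ ∧ A p ≠ ∞ ∧ 0 < (A p).toReal ∧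
      (A p).toReal = 1 - (p - 1) * y p := by
    filter_upwards [self_mem_nhdsWithin, hM.eventually (gt_mem_nhds hMT.lt_top)] with p hp hMp
    have hp' : 1 < p := hp
    have hp1 : 0 < p - 1 := by linarith
    have hQp : Q p ≠ ∞ := by
      refine ne_top_of_le_ne_top (ENNReal.ofReal_ne_top (r := 1 / (p - 1))) ?_
      calc Q p ≤ ∫⁻ x, ENNReal.ofReal (1 / (p - 1)) * ENNReal.ofReal (g x) ∂μ := by
            refine lintegral_mono fun x => ?_
            rw [← ENNReal.ofReal_mul (by positivity)]
            refine ENNReal.ofReal_le_ofReal ?_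
            have h2 : 0 ≤ g x ^ p := Real.rpow_nonneg (h0 x) p
            rw [one_div_mul_eq_div]
            exact div_le_div_of_nonneg_right (by linarith) hp1.le
        _ = ENNReal.ofReal (1 / (p - 1)) := by
            rw [lintegral_const_mul _ (by fun_prop), h1, mul_one]
    have hid : A p + ENNReal.ofReal (p - 1) * Q p = 1 + ENNReal.ofReal (p - 1) * M p := by
      rw [← h1]
      exact lintegral_rpow_add_eq hg hp' h0
    have hAT : A p ≠ ∞ := by
      refine ne_top_of_le_ne_top ?_ (le_self_add.trans_eq hid)
      exact ENNReal.add_ne_top.2 ⟨ENNReal.one_ne_top,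
        ENNReal.mul_ne_top ENNReal.ofReal_ne_top hMp.ne⟩
    have hA0 : A p ≠ 0 := by
      intro hz
      have hae := (lintegral_eq_zero_iff (by fun_prop)).1 hz
      have hg0 : (fun x => ENNReal.ofReal (g x)) =ᵐ[μ] 0 := by
        filter_upwards [hae] with x hx
        have hx' : g x ^ p ≤ 0 := ENNReal.ofReal_eq_zero.1 hx
        have hx0 : g x = 0 := by
          by_contra hne
          exact absurd (Real.rpow_pos_of_pos ((h0 x).lt_of_ne' hne) p) hx'.not_gt
        simp [hx0]
      rw [lintegral_congr_ae hg0] at h1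
      simp at h1
    refine ⟨hp, hQp, hMp.ne, hAT, ENNReal.toReal_pos hA0 hAT, ?_⟩
    have := congrArg ENNReal.toReal hid
    rw [ENNReal.toReal_add hAT (ENNReal.mul_ne_top ENNReal.ofReal_ne_top hQp),
      ENNReal.toReal_add ENNReal.one_ne_top (ENNReal.mul_ne_top ENNReal.ofReal_ne_top hMp.ne),
      ENNReal.toReal_mul, ENNReal.toReal_mul, ENNReal.toReal_ofReal hp1.le,
      ENNReal.toReal_one] at this
    rw [hy]
    linear_combination this
  have hform : ∀ᶠ p in 𝓝[>] (1 : ℝ), ((-(Real.log (A p).toReal / (p - 1)) : ℝ) : EReal) =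
      ((1 / (1 - p) : ℝ) : EReal) * ENNReal.log (A p) := by
    filter_upwards [hev] with p hp
    obtain ⟨hp1, -, -, hAT, hA0, -⟩ := hp
    rw [ENNReal.log_pos_real' hA0, ← EReal.coe_mul]
    congr 1
    rw [← neg_sub p 1, div_neg, neg_mul, one_div_mul_eq_div]
  refine Tendsto.congr' hform ?_
  have hlow : ∀ᶠ p in 𝓝[>] (1 : ℝ), y p ≤ -(Real.log (A p).toReal / (p - 1)) := by
    filter_upwards [hev] with p hp
    obtain ⟨hp1, -, -, -, hA0, hAe⟩ := hp
    have := Real.log_le_sub_one_of_pos hA0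
    rw [le_neg, div_le_iff₀ (by linarith)]
    linarith
  by_cases hQT : Q₁ = ∞
  · -- infinite entropy: the lower bound alone suffices
    have htop : ((Q₁ : ℝ≥0∞) : EReal) - (M₁ : EReal) = ⊤ := by
      rw [hQT, EReal.coe_ennreal_top, ← ENNReal.ofReal_toReal hMT]
      exact EReal.top_sub_coe _
    rw [htop]
    have hyT : Tendsto y (𝓝[>] 1) atTop := by
      have hM' : Tendsto (fun p => -(M p).toReal) (𝓝[>] 1) (𝓝 (-M₁.toReal)) :=
        ((ENNReal.tendsto_toReal hMT).comp hM).neg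
      have hQ' : Tendsto (fun p => (Q p).toReal) (𝓝[>] 1) atTop := by
        refine tendsto_atTop.2 fun b => ?_
        rw [hQT] at hQ
        filter_upwards [hev, hQ.eventually (lt_mem_nhds (ENNReal.ofReal_lt_top (r := b)))]
          with p hp hb
        exact (ENNReal.ofReal_le_iff_le_toReal hp.2.1).1 hb.le
      exact hQ'.atTop_add hM'
    exact EReal.tendsto_coe_nhds_top_iff.2 (tendsto_atTop_mono' _ hlow hyT)
  · have hlim : ((Q₁ : ℝ≥0∞) : EReal) - (M₁ : EReal) = ((Q₁.toReal - M₁.toReal : ℝ) : EReal) := by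
      rw [EReal.coe_sub, EReal.coe_ennreal_toReal hQT, EReal.coe_ennreal_toReal hMT]
    rw [hlim]
    refine EReal.tendsto_coe.2 ?_
    have hyl : Tendsto y (𝓝[>] 1) (𝓝 (Q₁.toReal - M₁.toReal)) :=
      ((ENNReal.tendsto_toReal hQT).comp hQ).sub ((ENNReal.tendsto_toReal hMT).comp hM)
    have hp0 : Tendsto (fun p : ℝ => p - 1) (𝓝[>] 1) (𝓝 0) := by
      have : Tendsto (fun p : ℝ => p - 1) (𝓝 1) (𝓝 (1 - 1)) := tendsto_id.sub_const 1
      rw [sub_self] at this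
      exact this.mono_left nhdsWithin_le_nhds
    have hAl : Tendsto (fun p => 1 - (p - 1) * y p) (𝓝[>] 1) (𝓝 1) := by
      simpa using (hp0.mul hyl).const_sub 1
    have hup : ∀ᶠ p in 𝓝[>] (1 : ℝ),
        -(Real.log (A p).toReal / (p - 1)) ≤ y p / (1 - (p - 1) * y p) := by
      filter_upwards [hev] with p hp
      obtain ⟨hp1, -, -, -, hA0, hAe⟩ := hp
      have := Real.one_sub_inv_le_log_of_pos hA0
      rw [hAe] at this hA0 ⊢
      rw [neg_le, le_div_iff₀ (by linarith)]
      refine le_trans (le_of_eq ?_) this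
      have hne : 1 - (p - 1) * y p ≠ 0 := hA0.ne'
      rw [eq_sub_iff_add_eq, inv_eq_one_div, ← neg_div, div_mul_eq_mul_div, ← add_div,
        div_eq_one_iff_eq hne]
      ring
    refine tendsto_of_tendsto_of_tendsto_of_le_of_le' hyl ?_ hlow hup
    have hquot := hyl.div hAl one_ne_zero
    rw [div_one] at hquot
    exact hquot

end EntropyIntegrals

section ShannonLimit

variable {Ω : Type*} [MeasurableSpace Ω] {D : ℕ} {P : Measure Ω} [IsProbabilityMeasure P]
  {X : Ω → EuclideanSpace ℝ (Fin D)}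

lemma lintegral_pdf_rpow_eq_toReal {p : ℝ} (hp : 0 ≤ p) :
    ∫⁻ x, pdf X P volume x ^ p = ∫⁻ x, ENNReal.ofReal ((pdf X P volume x).toReal ^ p) := by
  refine lintegral_congr_ae ?_
  filter_upwards [(pdf.ae_lt_top : ∀ᵐ x, pdf X P volume x < ∞)] with x hx
  rw [← ENNReal.ofReal_rpow_of_nonneg ENNReal.toReal_nonneg hp, ENNReal.ofReal_toReal hx.ne]

lemma tendsto_renyiEntropy (hX : HasPDF X P volume) {s : ℝ} (hs : 1 < s)
    (h : MemLp (pdf X P volume) (ENNReal.ofReal s) volume) :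
    Tendsto (fun p => renyiEntropy p X P) (𝓝[>] 1) (𝓝 (shannonEntropy X P)) := by
  have hs0 : 0 < s := by linarith
  have hm : Measurable fun x => (pdf X P volume x).toReal :=
    (measurable_pdf X P volume).ennreal_toReal
  have h1 : ∫⁻ x, ENNReal.ofReal (pdf X P volume x).toReal = 1 := by
    have := lintegral_pdf_rpow_eq_toReal (X := X) (P := P) zero_le_one
    simp only [ENNReal.rpow_one, Real.rpow_one] at this
    rw [← this, lintegral_pdf hX]
  have hgs := (memLp_pdf_iff_lintegral hs0).1 h
  rw [lintegral_pdf_rpow_eq_toReal hs0.le] at hgs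
  refine (tendsto_log_lintegral_rpow hm (fun x => ENNReal.toReal_nonneg) h1 hs hgs).congr' ?_
  filter_upwards [self_mem_nhdsWithin] with p hp
  rw [renyiEntropy, lintegral_pdf_rpow_eq_toReal (by linarith [mem_Ioi.1 hp])]

/-- Membership of the density in `L^s` bounds the negative part of the entropy integral. -/
lemma shannonEntropy_ne_bot {s : ℝ} (hs : 1 < s)
    (h : MemLp (pdf X P volume) (ENNReal.ofReal s) volume) : shannonEntropy X P ≠ ⊥ := by
  have hs0 : 0 < s := by linarith
  have hm : Measurable fun x => (pdf X P volume x).toReal :=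
    (measurable_pdf X P volume).ennreal_toReal
  have hgs := (memLp_pdf_iff_lintegral hs0).1 h
  rw [lintegral_pdf_rpow_eq_toReal hs0.le] at hgs
  have hMT := lintegral_neg_negMulLog_ne_top (fun x => ENNReal.toReal_nonneg) hs hgs hm
  rw [shannonEntropy, ← ENNReal.ofReal_toReal hMT, sub_eq_add_neg]
  refine EReal.add_ne_bot_iff.2 ⟨EReal.coe_ennreal_ne_bot _, ?_⟩
  simp [EReal.coe_ennreal_ofReal]

lemma tendsto_renyiEntropyPower (hD : 0 < D) (hX : HasPDF X P volume) {s : ℝ} (hs : 1 < s)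
    (h : MemLp (pdf X P volume) (ENNReal.ofReal s) volume) :
    Tendsto (fun p => renyiEntropyPower p X P) (𝓝[>] 1) (𝓝 (shannonEntropyPower X P)) := by
  have hD' : (0 : ℝ) < 2 / D := by positivity
  have hlog : Tendsto (fun p : ℝ => Real.log p / (p - 1)) (𝓝[>] 1) (𝓝 1) := by
    have h1 := (Real.hasDerivAt_log one_ne_zero).tendsto_slope
    rw [inv_one] at h1
    refine (h1.mono_left (nhdsWithin_mono 1 (fun p (hp : 1 < p) => hp.ne'))).congr fun p => ?_
    rw [slope_def_field, Real.log_one, sub_zero]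
  have hconst : Tendsto (fun p : ℝ => (2 * Real.pi)⁻¹ * p ^ (-(1 / (p - 1)))) (𝓝[>] 1)
      (𝓝 (2 * Real.pi * Real.exp 1)⁻¹) := by
    have h2 := ((Real.continuous_exp.tendsto _).comp hlog.neg).const_mul (2 * Real.pi)⁻¹
    rw [mul_inv (2 * Real.pi), ← Real.exp_neg]
    refine h2.congr' ?_
    filter_upwards [self_mem_nhdsWithin] with p hp
    rw [Function.comp_apply, Real.rpow_def_of_pos (by linarith [mem_Ioi.1 hp])]
    congr 2
    ring
  have hmul : Tendsto (fun p => ((2 / D : ℝ) : EReal) * renyiEntropy p X P) (𝓝[>] 1)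
      (𝓝 (((2 / D : ℝ) : EReal) * shannonEntropy X P)) := by
    refine EReal.Tendsto.const_mul (tendsto_renyiEntropy hX hs h) ?_ ?_
    · exact Or.inl (EReal.coe_ne_bot _)
    · exact Or.inl (EReal.coe_ne_top _)
  have hexp := (ENNReal.continuous_exp.tendsto _).comp hmul
  have hc0 : 0 < (2 * Real.pi * Real.exp 1)⁻¹ := by positivity
  have := ENNReal.Tendsto.mul (ENNReal.tendsto_ofReal hconst)
    (Or.inl (ENNReal.ofReal_pos.2 hc0).ne') hexp (Or.inr ENNReal.ofReal_ne_top)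
  rw [shannonEntropyPower, div_eq_mul_inv, mul_comm,
    ← ENNReal.ofReal_inv_of_pos (by positivity)]
  refine this.congr' ?_
  filter_upwards [self_mem_nhdsWithin] with p hp
  rw [renyiEntropyPower_eq_exp hp, Function.comp_apply]

lemma shannonEntropyPower_pos (hD : 0 < D) {s : ℝ} (hs : 1 < s)
    (h : MemLp (pdf X P volume) (ENNReal.ofReal s) volume) : 0 < shannonEntropyPower X P := by
  have hD' : (0 : ℝ) < 2 / D := by positivity
  refine ENNReal.div_pos ?_ ENNReal.ofReal_ne_top
  rw [Ne, EReal.exp_eq_zero_iff]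
  intro hb
  refine shannonEntropy_ne_bot hs h (EReal.coe_mul_injective hD'.ne' ?_)
  simp only
  rw [hb, EReal.coe_mul_bot_of_pos hD']

end ShannonLimit

/-! ### Optimising the weight -/

lemma weightedPowerBound_ofReal {t x y : ℝ} (ht0 : 0 < t) (ht1 : t < 1) (hx : 0 ≤ x)
    (hy : 0 ≤ y) :
    weightedPowerBound t (ENNReal.ofReal x) (ENNReal.ofReal y) =
      ENNReal.ofReal ((x / (1 - t)) ^ (1 - t) * (y / t) ^ t) := by
  have hs : 0 < 1 - t := by linarith
  unfold weightedPowerBound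
  rw [← ENNReal.ofReal_div_of_pos hs, ← ENNReal.ofReal_div_of_pos ht0,
    ENNReal.ofReal_rpow_of_nonneg (by positivity) hs.le,
    ENNReal.ofReal_rpow_of_nonneg (by positivity) ht0.le, ← ENNReal.ofReal_mul (by positivity)]

lemma weightedPowerBound_le_add {t : ℝ} (ht0 : 0 < t) (ht1 : t < 1) (a b : ℝ≥0∞) :
    weightedPowerBound t a b ≤ a + b := by
  have hs : 0 < 1 - t := by linarith
  rcases eq_or_ne a ∞ with rfl | ha
  · simp
  rcases eq_or_ne b ∞ with rfl | hb
  · simp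
  rw [← ENNReal.ofReal_toReal ha, ← ENNReal.ofReal_toReal hb,
    weightedPowerBound_ofReal ht0 ht1 ENNReal.toReal_nonneg ENNReal.toReal_nonneg,
    ← ENNReal.ofReal_add ENNReal.toReal_nonneg ENNReal.toReal_nonneg]
  refine ENNReal.ofReal_le_ofReal ?_
  refine (Real.geom_mean_le_arith_mean2_weighted hs.le ht0.le
    (div_nonneg ENNReal.toReal_nonneg hs.le) (div_nonneg ENNReal.toReal_nonneg ht0.le)
    (by ring)).trans_eq ?_
  rw [mul_div_cancel₀ _ hs.ne', mul_div_cancel₀ _ ht0.ne']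

/-- For finite powers the optimal weight is proportional to the second one; if one of the powers
is infinite, every weight is optimal. -/
lemma exists_weightedPowerBound_eq_add {a b : ℝ≥0∞} (ha : 0 < a) (hb : 0 < b) :
    ∃ t ∈ Ioo (0 : ℝ) 1, weightedPowerBound t a b = a + b := by
  have hpos : ∀ {c : ℝ≥0∞}, 0 < c → (c / ENNReal.ofReal (1 / 2)) ^ (1 / 2 : ℝ) ≠ 0 := fun hc =>
    (ENNReal.rpow_pos_of_nonneg (ENNReal.div_pos hc.ne' ENNReal.ofReal_ne_top)
      (by norm_num)).ne'
  have htop : ((∞ : ℝ≥0∞) / ENNReal.ofReal (1 / 2)) ^ (1 / 2 : ℝ) = ∞ := by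
    rw [ENNReal.top_div_of_ne_top ENNReal.ofReal_ne_top, ENNReal.top_rpow_of_pos (by norm_num)]
  have hhalf : (1 : ℝ) - 1 / 2 = 1 / 2 := by norm_num
  rcases eq_or_ne a ∞ with rfl | haT
  · refine ⟨1 / 2, ⟨by norm_num, by norm_num⟩, ?_⟩
    rw [weightedPowerBound, hhalf, htop, ENNReal.top_mul (hpos hb), top_add]
  rcases eq_or_ne b ∞ with rfl | hbT
  · refine ⟨1 / 2, ⟨by norm_num, by norm_num⟩, ?_⟩
    rw [weightedPowerBound, hhalf, htop, ENNReal.mul_top (hpos ha), add_top]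
  have hx : 0 < a.toReal := ENNReal.toReal_pos ha.ne' haT
  have hy : 0 < b.toReal := ENNReal.toReal_pos hb.ne' hbT
  rw [← ENNReal.ofReal_toReal haT, ← ENNReal.ofReal_toReal hbT]
  set x := a.toReal
  set y := b.toReal
  have hxy : 0 < x + y := add_pos hx hy
  have ht0 : 0 < y / (x + y) := div_pos hy hxy
  have ht1 : y / (x + y) < 1 := (div_lt_one hxy).2 (by linarith)
  refine ⟨y / (x + y), ⟨ht0, ht1⟩, ?_⟩
  rw [weightedPowerBound_ofReal ht0 ht1 hx.le hy.le, ← ENNReal.ofReal_add hx.le hy.le]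
  have e : 1 - y / (x + y) = x / (x + y) := by field_simp; ring
  have e₁ : x / (x / (x + y)) = x + y := by field_simp
  have e₂ : y / (y / (x + y)) = x + y := by field_simp
  rw [e, e₁, e₂, ← Real.rpow_add hxy, ← add_div, div_self hxy.ne', Real.rpow_one]

lemma isGreatest_weightedPowerBound {a b : ℝ≥0∞} (ha : 0 < a) (hb : 0 < b) :
    IsGreatest ((fun t : ℝ => weightedPowerBound t a b) '' Ioo 0 1) (a + b) := by
  obtain ⟨t, ht, h⟩ := exists_weightedPowerBound_eq_add ha hb
  refine ⟨⟨t, ht, h⟩, ?_⟩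
  rintro _ ⟨u, hu, rfl⟩
  exact weightedPowerBound_le_add hu.1 hu.2 a b

/-- Positivity of the limits excludes the indeterminate product `0 * ∞`. -/
lemma tendsto_weightedPowerBound {ι : Type*} {l : Filter ι} {u v : ι → ℝ≥0∞} {a b : ℝ≥0∞}
    {t : ℝ} (ht0 : 0 < t) (ht1 : t < 1) (ha : 0 < a) (hb : 0 < b) (hu : Tendsto u l (𝓝 a))
    (hv : Tendsto v l (𝓝 b)) :
    Tendsto (fun i => weightedPowerBound t (u i) (v i)) l (𝓝 (weightedPowerBound t a b)) := by
  have hs : 0 < 1 - t := by linarith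
  have h : ∀ {c : ℝ≥0∞} {w : ι → ℝ≥0∞} {τ : ℝ}, 0 < τ → 0 < c → Tendsto w l (𝓝 c) →
      Tendsto (fun i => (w i / ENNReal.ofReal τ) ^ τ) l (𝓝 ((c / ENNReal.ofReal τ) ^ τ)) ∧
        (c / ENNReal.ofReal τ) ^ τ ≠ 0 := fun hτ hc hw =>
    ⟨(ENNReal.continuous_rpow_const.tendsto _).comp
      (ENNReal.Tendsto.div_const hw (Or.inl hc.ne')),
    (ENNReal.rpow_pos_of_nonneg (ENNReal.div_pos hc.ne' ENNReal.ofReal_ne_top) hτ.le).ne'⟩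
  obtain ⟨h₁, n₁⟩ := h hs ha hu
  obtain ⟨h₂, n₂⟩ := h ht0 hb hv
  exact ENNReal.Tendsto.mul h₁ (Or.inl n₁) h₂ (Or.inl n₂)

/-! ### Shannon's entropy power inequality -/

/-- The exponents `r / ((1 - t) + t * r)` lie strictly between `1` and `r`. -/
lemma young_exponent_mem_Ioo {r t : ℝ} (hr : 1 < r) (ht0 : 0 < t) (ht1 : t < 1) :
    r / ((1 - t) + t * r) ∈ Ioo 1 r := by
  have hs : 0 < 1 - t := by linarith
  have hu : 0 < (1 - t) + t * r := by nlinarith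
  have h := mul_pos (mul_pos (zero_lt_one.trans hr) ht0) (sub_pos.2 hr)
  exact ⟨by rw [one_lt_div hu]; nlinarith, by rw [div_lt_iff₀ hu]; nlinarith⟩

lemma tendsto_young_exponent {t : ℝ} (ht0 : 0 < t) (ht1 : t < 1) :
    Tendsto (fun r : ℝ => r / ((1 - t) + t * r)) (𝓝[>] 1) (𝓝[>] 1) := by
  refine tendsto_nhdsWithin_iff.2 ⟨?_, ?_⟩
  · have hid : Tendsto (fun r : ℝ => r) (𝓝[>] 1) (𝓝 1) := nhdsWithin_le_nhds
    refine tendsto_of_tendsto_of_tendsto_of_le_of_le' tendsto_const_nhds hid ?_ ?_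
    · filter_upwards [self_mem_nhdsWithin] with r hr
      exact (young_exponent_mem_Ioo hr ht0 ht1).1.le
    · filter_upwards [self_mem_nhdsWithin] with r hr
      exact (young_exponent_mem_Ioo hr ht0 ht1).2.le
  · filter_upwards [self_mem_nhdsWithin] with r hr
    exact (young_exponent_mem_Ioo hr ht0 ht1).1

section ShannonEPI

variable {Ω : Type*} [MeasurableSpace Ω] {D : ℕ} {P : Measure Ω} [IsProbabilityMeasure P]

/-- A probability density in `L^s` lies in `L^q` for all `1 ≤ q ≤ s`. -/
lemma memLp_pdf_of_le {X : Ω → EuclideanSpace ℝ (Fin D)} (hX : HasPDF X P volume) {q s : ℝ}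
    (hq : 1 ≤ q) (hqs : q ≤ s) (h : MemLp (pdf X P volume) (ENNReal.ofReal s) volume) :
    MemLp (pdf X P volume) (ENNReal.ofReal q) volume := by
  have hq0 : 0 < q := by linarith
  have hs := (memLp_pdf_iff_lintegral (by linarith)).1 h
  rw [memLp_pdf_iff_lintegral hq0]
  have hle : ∀ u : ℝ≥0∞, u ^ q ≤ u + u ^ s := fun u => by
    rcases le_total u 1 with hu | hu
    · refine le_add_right ?_
      simpa using ENNReal.rpow_le_rpow_of_exponent_ge hu hq
    · exact le_add_left (ENNReal.rpow_le_rpow_of_exponent_le hu hqs)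
  refine ne_top_of_le_ne_top ?_ (lintegral_mono fun x => hle (pdf X P volume x))
  rw [lintegral_add_left (measurable_pdf X P volume), lintegral_pdf hX]
  exact ENNReal.add_ne_top.2 ⟨ENNReal.one_ne_top, hs⟩

lemma exists_memLp_pdf_add {s₁ s₂ : ℝ} {X₁ X₂ : Ω → EuclideanSpace ℝ (Fin D)} (hs₁ : 1 < s₁)
    (hs₂ : 1 < s₂) (hX : IndepFun X₁ X₂ P) (h₁ : HasPDF X₁ P volume) (h₂ : HasPDF X₂ P volume)
    (m₁ : MemLp (pdf X₁ P volume) (ENNReal.ofReal s₁) volume)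
    (m₂ : MemLp (pdf X₂ P volume) (ENNReal.ofReal s₂) volume) :
    ∃ s, 1 < s ∧ MemLp (pdf (X₁ + X₂) P volume) (ENNReal.ofReal s) volume := by
  have hr : 1 < min s₁ s₂ := lt_min hs₁ hs₂
  have e := young_exponent_mem_Ioo (t := 1 / 2) hr (by norm_num) (by norm_num)
  have e' : min s₁ s₂ / (1 / 2 + (1 - 1 / 2) * min s₁ s₂) =
      min s₁ s₂ / ((1 - 1 / 2) + 1 / 2 * min s₁ s₂) := by norm_num
  refine ⟨min s₁ s₂, hr, memLp_pdf_add (t := 1 / 2) hr (by norm_num) (by norm_num) hX h₁ h₂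
    (memLp_pdf_of_le h₁ e.1.le (e.2.le.trans (min_le_left _ _)) m₁) ?_⟩
  rw [e']
  exact memLp_pdf_of_le h₂ e.1.le (e.2.le.trans (min_le_right _ _)) m₂

lemma tendsto_weightedPowerBound_renyiEntropyPower (hD : 0 < D) {s₁ s₂ t : ℝ}
    {X₁ X₂ : Ω → EuclideanSpace ℝ (Fin D)} (hs₁ : 1 < s₁) (hs₂ : 1 < s₂)
    (h₁ : HasPDF X₁ P volume) (h₂ : HasPDF X₂ P volume)
    (m₁ : MemLp (pdf X₁ P volume) (ENNReal.ofReal s₁) volume)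
    (m₂ : MemLp (pdf X₂ P volume) (ENNReal.ofReal s₂) volume) (ht0 : 0 < t) (ht1 : t < 1) :
    Tendsto (fun r : ℝ => weightedPowerBound t
        (renyiEntropyPower (r / ((1 - t) + t * r)) X₁ P)
        (renyiEntropyPower (r / (t + (1 - t) * r)) X₂ P)) (𝓝[>] 1)
      (𝓝 (weightedPowerBound t (shannonEntropyPower X₁ P) (shannonEntropyPower X₂ P))) := by
  have hp : Tendsto (fun r : ℝ => r / (t + (1 - t) * r)) (𝓝[>] 1) (𝓝[>] 1) := by
    have := tendsto_young_exponent (t := 1 - t) (by linarith) (by linarith)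
    simpa only [sub_sub_cancel] using this
  exact tendsto_weightedPowerBound ht0 ht1 (shannonEntropyPower_pos hD hs₁ m₁)
    (shannonEntropyPower_pos hD hs₂ m₂)
    ((tendsto_renyiEntropyPower hD h₁ hs₁ m₁).comp (tendsto_young_exponent ht0 ht1))
    ((tendsto_renyiEntropyPower hD h₂ hs₂ m₂).comp hp)

/-- The weighted form of Shannon's entropy power inequality, as the limit of the Rényi entropy
power inequality. -/
lemma weightedPowerBound_le_shannonEntropyPower_add (hD : 0 < D) {s₁ s₂ t : ℝ}
    {X₁ X₂ : Ω → EuclideanSpace ℝ (Fin D)} (hs₁ : 1 < s₁) (hs₂ : 1 < s₂) (hX : IndepFun X₁ X₂ P)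
    (h₁ : HasPDF X₁ P volume) (h₂ : HasPDF X₂ P volume)
    (m₁ : MemLp (pdf X₁ P volume) (ENNReal.ofReal s₁) volume)
    (m₂ : MemLp (pdf X₂ P volume) (ENNReal.ofReal s₂) volume) (ht0 : 0 < t) (ht1 : t < 1) :
    weightedPowerBound t (shannonEntropyPower X₁ P) (shannonEntropyPower X₂ P) ≤
      shannonEntropyPower (X₁ + X₂) P := by
  obtain ⟨s, hs, m⟩ := exists_memLp_pdf_add hs₁ hs₂ hX h₁ h₂ m₁ m₂
  refine le_of_tendsto_of_tendsto
    (tendsto_weightedPowerBound_renyiEntropyPower hD hs₁ hs₂ h₁ h₂ m₁ m₂ ht0 ht1)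
    (tendsto_renyiEntropyPower hD (IndepFun.add_hasPDF hX) hs m) ?_
  filter_upwards [Ioo_mem_nhdsGT (lt_min hs₁ hs₂)] with r hr
  have e₁ := young_exponent_mem_Ioo hr.1 ht0 ht1
  have e₂ := young_exponent_mem_Ioo (t := 1 - t) hr.1 (by linarith) (by linarith)
  rw [sub_sub_cancel] at e₂
  exact weightedPowerBound_le_renyiEntropyPower_add hD hr.1 ht0 ht1 hX h₁ h₂
    (memLp_pdf_of_le h₁ e₁.1.le ((e₁.2.trans hr.2).le.trans (min_le_left _ _)) m₁)
    (memLp_pdf_of_le h₂ e₂.1.le ((e₂.2.trans hr.2).le.trans (min_le_right _ _)) m₂)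

end ShannonEPI

theorem mainTheorem1 {D : ℕ} (hD : 0 < D) {Ω : Type*} [MeasurableSpace Ω]
    (P : Measure Ω) [IsProbabilityMeasure P] :
    -- `N_p(X)` is the unique `N > 0` with `I_p(X) = I_p(√N · Z_G)`
    (∀ (p : ℝ) (X : Ω → EuclideanSpace ℝ (Fin D)), 1 < p → HasPDF X P volume →
      MemLp (pdf X P volume) (ENNReal.ofReal p) volume →
      0 < renyiEntropyPower p X P ∧ renyiEntropyPower p X P < ∞ ∧
      ∀ {Ω' : Type*} [MeasurableSpace Ω'] (P' : Measure Ω') (Z : Ω' → EuclideanSpace ℝ (Fin D)),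
        HasLaw Z (stdGaussian (EuclideanSpace ℝ (Fin D))) P' →
        ∀ N : ℝ, 0 < N →
          (renyiEntropy p X P = renyiEntropy p (fun ω => √N • Z ω) P' ↔
            renyiEntropyPower p X P = ENNReal.ofReal N)) ∧
    -- `N_p(X) → N(X)` as `p → 1+`
    (∀ (s : ℝ) (X : Ω → EuclideanSpace ℝ (Fin D)), 1 < s → HasPDF X P volume →
      MemLp (pdf X P volume) (ENNReal.ofReal s) volume →
      Tendsto (fun p : ℝ => renyiEntropyPower p X P) (𝓝[>] 1) (𝓝 (shannonEntropyPower X P))) ∧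
    -- the Rényi entropy power inequality
    (∀ (r t q p : ℝ) (X₁ X₂ : Ω → EuclideanSpace ℝ (Fin D)), 1 < r → t ∈ Ioo (0 : ℝ) 1 →
      q = r / ((1 - t) + t * r) → p = r / (t + (1 - t) * r) →
      IndepFun X₁ X₂ P → HasPDF X₁ P volume → HasPDF X₂ P volume →
      MemLp (pdf X₁ P volume) (ENNReal.ofReal q) volume →
      MemLp (pdf X₂ P volume) (ENNReal.ofReal p) volume →
      HasPDF (X₁ + X₂) P volume ∧
      MemLp (pdf (X₁ + X₂) P volume) (ENNReal.ofReal r) volume ∧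
      weightedPowerBound t (renyiEntropyPower q X₁ P) (renyiEntropyPower p X₂ P) ≤
        renyiEntropyPower r (X₁ + X₂) P) ∧
    -- the limit `r, q, p → 1+` and the optimisation over the weight: Shannon's inequality
    (∀ (s₁ s₂ : ℝ) (X₁ X₂ : Ω → EuclideanSpace ℝ (Fin D)), 1 < s₁ → 1 < s₂ →
      IndepFun X₁ X₂ P → HasPDF X₁ P volume → HasPDF X₂ P volume →
      MemLp (pdf X₁ P volume) (ENNReal.ofReal s₁) volume →
      MemLp (pdf X₂ P volume) (ENNReal.ofReal s₂) volume →
      Tendsto (fun r : ℝ => renyiEntropyPower r (X₁ + X₂) P) (𝓝[>] 1)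
        (𝓝 (shannonEntropyPower (X₁ + X₂) P)) ∧
      (∀ t ∈ Ioo (0 : ℝ) 1,
        Tendsto (fun r : ℝ => weightedPowerBound t
            (renyiEntropyPower (r / ((1 - t) + t * r)) X₁ P)
            (renyiEntropyPower (r / (t + (1 - t) * r)) X₂ P)) (𝓝[>] 1)
          (𝓝 (weightedPowerBound t (shannonEntropyPower X₁ P) (shannonEntropyPower X₂ P))) ∧
        weightedPowerBound t (shannonEntropyPower X₁ P) (shannonEntropyPower X₂ P) ≤
          shannonEntropyPower (X₁ + X₂) P) ∧
      IsGreatest ((fun t : ℝ => weightedPowerBound t (shannonEntropyPower X₁ P)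
          (shannonEntropyPower X₂ P)) '' Ioo 0 1)
        (shannonEntropyPower X₁ P + shannonEntropyPower X₂ P) ∧
      shannonEntropyPower X₁ P + shannonEntropyPower X₂ P ≤
        shannonEntropyPower (X₁ + X₂) P) := by
  refine ⟨?_, ?_, ?_, ?_⟩
  · intro p X hp hX h
    obtain ⟨h0, hT⟩ := renyiEntropyPower_pos_lt_top hX hp h
    refine ⟨h0, hT, fun P' Z hZ N hN => ?_⟩
    rw [renyiEntropy_eq_iff_renyiEntropyPower_eq hD hp,
      renyiEntropyPower_smul_stdGaussian hD hZ hN hp]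
  · exact fun s X hs hX h => tendsto_renyiEntropyPower hD hX hs h
  · rintro r t q p X₁ X₂ hr ⟨ht0, ht1⟩ rfl rfl hX h₁ h₂ m₁ m₂
    exact ⟨IndepFun.add_hasPDF hX, memLp_pdf_add hr ht0 ht1 hX h₁ h₂ m₁ m₂,
      weightedPowerBound_le_renyiEntropyPower_add hD hr ht0 ht1 hX h₁ h₂ m₁ m₂⟩
  · intro s₁ s₂ X₁ X₂ hs₁ hs₂ hX h₁ h₂ m₁ m₂
    obtain ⟨s, hs, m⟩ := exists_memLp_pdf_add hs₁ hs₂ hX h₁ h₂ m₁ m₂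
    have hle : ∀ t ∈ Ioo (0 : ℝ) 1,
        weightedPowerBound t (shannonEntropyPower X₁ P) (shannonEntropyPower X₂ P) ≤
          shannonEntropyPower (X₁ + X₂) P := fun t ht =>
      weightedPowerBound_le_shannonEntropyPower_add hD hs₁ hs₂ hX h₁ h₂ m₁ m₂ ht.1 ht.2
    have hgr := isGreatest_weightedPowerBound (shannonEntropyPower_pos hD hs₁ m₁)
      (shannonEntropyPower_pos hD hs₂ m₂)
    refine ⟨tendsto_renyiEntropyPower hD (IndepFun.add_hasPDF hX) hs m, fun t ht => ⟨?_, hle t ht⟩,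
      hgr, ?_⟩
    · exact tendsto_weightedPowerBound_renyiEntropyPower hD hs₁ hs₂ h₁ h₂ m₁ m₂ ht.1 ht.2
    · obtain ⟨t, ht, he⟩ := hgr.1
      exact he.symm.trans_le (hle t ht)
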